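/- Let $A\in\mathbb R^{n\times n}$ and $B\in\mathbb R^{n\times m}$ be such that $(A,B)$ is stabilizable, i.e. $\rho(A-BK_0)<1$ for some $K_0\in\mathbb R^{m\times n}$, and let $Q\succeq 0$, $R\succ 0$, $Q_f\succeq 0$ be real symmetric matrices. Consider the system $x_{t+1}=Ax_t+Bu_t+w_t$, $x_0=0$, where $w_0,w_1,\dots$ are i.i.d. random vectors in $\mathbb R^n$ with $\mathbb E\|w_0\|^2<\infty$ (for instance, of bounded support), mean zero and covariance matrix $W$. For each horizon $T$ and each realization of the noise there are unique control actions $u_0^*,\dots,u_{T-1}^*$ (the optimal offline policy, which may depend on the whole sequence $w_0,\dots,w_{T-1}$) minimizing $$\sum_{t=0}^{T-1}\left(x_t^\top Qx_t+u_t^\top Ru_t\right)+x_T^\top Q_fx_T .$$ Let $P\succeq 0$ be a positive semidefinite solution of the algebraic Riccati equation $$P=Q+A^\top PA-A^\top PB(R+B^\top PB)^{-1}B^\top PA,$$ and put $S=P-PB(R+B^\top PB)^{-1}B^\top P$ and $K=(R+B^\top PB)^{-1}B^\top PA$ (Kalman's gain, of the online policy $u_t=-Kx_t$). Then the time-averaged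 infinite-horizon cost of the optimal offline policy is $$\lim_{T\to\infty}\mathbb E\left[\frac1T\sum_{t=0}^{T-1}\left(x_t^\top Qx_t+(u_t^*)^\top Ru_t^*\right)\right]=\operatorname{Tr}(WS)-\sum_{i=0}^{\infty}\operatorname{Tr}\left(W S A (A-BK)^{i} B (R+B^\top PB)^{-1}B^\top \left((A-BK)^\top\right)^{i} A^\top S\right),$$ where $x_t$ is the state under $u^*$, the expectations are finite and the series converges; the limit is the same if the terminal cost $x_T^\top Q_fx_T$ is added to the sum on the left. -/

import Mathlib

open Matrix MeasureTheory ProbabilityTheory Filter Topology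

namespace LQR

noncomputable section

/-- The pair `(A, B)` is stabilizable: some feedback gain `K` makes the spectral radius of
`A - B K` (over all complex eigenvalues) smaller than `1`. -/
def Stabilizable {n m : ℕ} (A : Matrix (Fin n) (Fin n) ℝ) (B : Matrix (Fin n) (Fin m) ℝ) : Prop :=
  ∃ K : Matrix (Fin m) (Fin n) ℝ,
    spectralRadius ℂ ((A - B * K).map (algebraMap ℝ ℂ)) < 1

/-- The state `x_t` of the system `x_{t+1} = A x_t + B u_t + w_t`, started at `x_0 = 0`. -/
def state {n m : ℕ} (A : Matrix (Fin n) (Fin n) ℝ) (B : Matrix (Fin n) (Fin m) ℝ)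
    (w : ℕ → Fin n → ℝ) (u : ℕ → Fin m → ℝ) : ℕ → Fin n → ℝ
  | 0 => 0
  | t + 1 => A *ᵥ state A B w u t + B *ᵥ u t + w t

/-- The cost `∑_{t < T} x_tᵀ Q x_t + u_tᵀ R u_t`; it depends only on `u_0, …, u_{T-1}` and
on the noise before time `T`. -/
def runningCost {n m : ℕ} (A : Matrix (Fin n) (Fin n) ℝ) (B : Matrix (Fin n) (Fin m) ℝ)
    (Q : Matrix (Fin n) (Fin n) ℝ) (R : Matrix (Fin m) (Fin m) ℝ) (T : ℕ)
    (w : ℕ → Fin n → ℝ) (u : ℕ → Fin m → ℝ) : ℝ :=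
  ∑ t ∈ Finset.range T,
    (state A B w u t ⬝ᵥ Q *ᵥ state A B w u t + u t ⬝ᵥ R *ᵥ u t)

/-- The running cost over `T` rounds plus the terminal cost `x_Tᵀ Q_f x_T`. -/
def totalCost {n m : ℕ} (A : Matrix (Fin n) (Fin n) ℝ) (B : Matrix (Fin n) (Fin m) ℝ)
    (Q : Matrix (Fin n) (Fin n) ℝ) (R : Matrix (Fin m) (Fin m) ℝ)
    (Qf : Matrix (Fin n) (Fin n) ℝ) (T : ℕ)
    (w : ℕ → Fin n → ℝ) (u : ℕ → Fin m → ℝ) : ℝ :=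
  runningCost A B Q R T w u + state A B w u T ⬝ᵥ Qf *ᵥ state A B w u T

/-- `u_0, …, u_{T-1}` are optimal offline control actions for the noise realization `w`: they
minimize the total cost among all sequences of control actions, with `w` fixed. -/
def IsOptimalOffline {n m : ℕ} (A : Matrix (Fin n) (Fin n) ℝ) (B : Matrix (Fin n) (Fin m) ℝ)
    (Q : Matrix (Fin n) (Fin n) ℝ) (R : Matrix (Fin m) (Fin m) ℝ)
    (Qf : Matrix (Fin n) (Fin n) ℝ) (T : ℕ)
    (w : ℕ → Fin n → ℝ) (u : ℕ → Fin m → ℝ) : Prop :=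
  ∀ u' : ℕ → Fin m → ℝ, totalCost A B Q R Qf T w u ≤ totalCost A B Q R Qf T w u'

/-- `P` is a positive semidefinite solution of the discrete algebraic Riccati equation. -/
def IsRiccatiSolution {n m : ℕ} (A : Matrix (Fin n) (Fin n) ℝ) (B : Matrix (Fin n) (Fin m) ℝ)
    (Q : Matrix (Fin n) (Fin n) ℝ) (R : Matrix (Fin m) (Fin m) ℝ)
    (P : Matrix (Fin n) (Fin n) ℝ) : Prop :=
  P.PosSemidef ∧ P = Q + Aᵀ * P * A - Aᵀ * P * B * (R + Bᵀ * P * B)⁻¹ * Bᵀ * P * A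

/-- The gain `K = (R + Bᵀ P B)⁻¹ Bᵀ P A` of Kalman's online policy `u_t = - K x_t`. -/
def kalmanGain {n m : ℕ} (A : Matrix (Fin n) (Fin n) ℝ) (B : Matrix (Fin n) (Fin m) ℝ)
    (R : Matrix (Fin m) (Fin m) ℝ) (P : Matrix (Fin n) (Fin n) ℝ) : Matrix (Fin m) (Fin n) ℝ :=
  (R + Bᵀ * P * B)⁻¹ * Bᵀ * P * A

/-- `S = P - P B (R + Bᵀ P B)⁻¹ Bᵀ P`. -/
def schurS {n m : ℕ} (B : Matrix (Fin n) (Fin m) ℝ)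
    (R : Matrix (Fin m) (Fin m) ℝ) (P : Matrix (Fin n) (Fin n) ℝ) : Matrix (Fin n) (Fin n) ℝ :=
  P - P * B * (R + Bᵀ * P * B)⁻¹ * Bᵀ * P

/-- The covariance matrix of a random vector. -/
def covMatrix {n : ℕ} {Ω : Type*} [MeasurableSpace Ω] (μ : Measure Ω) (X : Ω → Fin n → ℝ) :
    Matrix (Fin n) (Fin n) ℝ :=
  Matrix.of fun i j => covariance (fun ω => X ω i) (fun ω => X ω j) μ

/-- The `i`-th correction term
`Tr(W S A (A - B K)^i B (R + Bᵀ P B)⁻¹ Bᵀ ((A - B K)ᵀ)^i Aᵀ S)`. -/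
def offlineTerm {n m : ℕ} (A : Matrix (Fin n) (Fin n) ℝ) (B : Matrix (Fin n) (Fin m) ℝ)
    (R : Matrix (Fin m) (Fin m) ℝ) (P W : Matrix (Fin n) (Fin n) ℝ) (i : ℕ) : ℝ :=
  (W * schurS B R P * A * (A - B * kalmanGain A B R P) ^ i * B * (R + Bᵀ * P * B)⁻¹ * Bᵀ *
    ((A - B * kalmanGain A B R P)ᵀ) ^ i * Aᵀ * schurS B R P).trace

end

end LQR

namespace LQR

noncomputable section

open Polynomial

/-! ### Square sums of coefficients over `ℂ` -/

/-! For a fixed noise sequence, completing squares backwards in time writes the total cost as an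
explicit optimal value plus a positive definite sum of squares in the controls (`totalCost_eq`). So
the offline optimum exists, is unique, and is linear in the noise.

If the terminal weight is the Riccati solution P, the backward recursion stands still. With L = A -
BK, the vector entering the step at time t with k later steps to go is the sum of (Lᵀ)^i P w_{t+i}
over i ≤ k. Since the noise is uncorrelated in time, the expected cost of that step is exactly
Tr(WS) minus the first k correction terms (`IsRiccatiSolution.integral_stepCost`). These terms are
nonnegative and the optimal value is nonnegative, so the partial sums are bounded. The series
converges, and Cesàro averaging gives the limit. Stability of L is never needed, so any positive
semidefinite solution P will do.

It remains to see that the terminal weight is irrelevant on average. Stabilizability gives a weight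
Y above both Qf and P, and every cost in question lies between the expected optimal values J_0 and
J_Y for the terminal weights 0 and Y. The heart is J_Y ≤ (1 + η) J_0 + ηT + D
(`exists_integral_optValue_le`). The obstacle is that a trajectory optimal for weight 0 may grow
exponentially in modes which Q does not see, and is then too expensive to stabilize at the end.

The cure is to filter the trajectory in time. The system is linear, time invariant and starts at 0,
so a polynomial in the delay maps trajectories to trajectories. Three properties of the filter are
used. As a multiple of det(1 - XA) it turns the state into a finite impulse response to controls and
noise, so the energy of the filtered state is O(T) in mean and at some time near T stabilizing is
cheap. As a contraction of ℓ² it does not increase the cost. Being close to a delay X^N, it sends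
the advanced noise w_{N+t} close to w_t in mean square, and the difference is absorbed by a
stabilizing feedback. The advanced noise has the same expected optimal value, because only second
moments matter (`integral_optValue_eq`).

Such a filter exists for every nonzero polynomial χ (`exists_filter_laurent`): multiples of χ
approximate powers of X in ℓ² wherever the zeros of χ lie, and 1 - D^(2k) with D = 1 - c⁻¹χχ*
upgrades the approximation to a contraction. -/

/-- The square sum of the coefficients of `p` is at most `ε`. -/
def CoeffSqLe (p : ℂ[X]) (ε : ℝ) : Prop := ∀ s : ℕ, ∑ i ∈ Finset.range s, ‖p.coeff i‖ ^ 2 ≤ ε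

lemma CoeffSqLe.add {p q : ℂ[X]} {ε δ : ℝ} (hp : CoeffSqLe p ε) (hq : CoeffSqLe q δ) :
    CoeffSqLe (p + q) (2 * ε + 2 * δ) := by
  intro s
  calc ∑ i ∈ Finset.range s, ‖(p + q).coeff i‖ ^ 2
      ≤ ∑ i ∈ Finset.range s, (2 * ‖p.coeff i‖ ^ 2 + 2 * ‖q.coeff i‖ ^ 2) := by
        refine Finset.sum_le_sum fun i _ => ?_
        rw [coeff_add]
        have h := norm_add_le (p.coeff i) (q.coeff i)
        have h0 := norm_nonneg (p.coeff i + q.coeff i)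
        nlinarith [sq_nonneg (‖p.coeff i‖ - ‖q.coeff i‖)]
    _ ≤ _ := by
        rw [Finset.sum_add_distrib, ← Finset.mul_sum, ← Finset.mul_sum]
        linarith [hp s, hq s]

lemma CoeffSqLe.X_pow_mul {p : ℂ[X]} {ε : ℝ} (hp : CoeffSqLe p ε) (k : ℕ) :
    CoeffSqLe (X ^ k * p) ε := by
  induction k with
  | zero => simpa using hp
  | succ k ih =>
    have h : ∀ q : ℂ[X], CoeffSqLe q ε → CoeffSqLe (X * q) ε := by
      intro q hq s
      cases s with
      | zero => simpa using hq 0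
      | succ s => rw [Finset.sum_range_succ']; simpa [coeff_X_mul] using hq s
    rw [pow_succ', mul_assoc]
    exact h _ ih

lemma CoeffSqLe.C_mul {p : ℂ[X]} {ε : ℝ} (hp : CoeffSqLe p ε) (a : ℂ) :
    CoeffSqLe (C a * p) (‖a‖ ^ 2 * ε) := by
  intro s
  simp only [coeff_C_mul, norm_mul, mul_pow, ← Finset.mul_sum]
  exact mul_le_mul_of_nonneg_left (hp s) (by positivity)

/-- Multiplication by a fixed polynomial is a sum of scaled shifts, hence bounded on ℓ². Only the
existence of some constant matters. -/
lemma exists_coeffSqLe_mul (p : ℂ[X]) :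
    ∃ c : ℝ, 0 < c ∧ ∀ q ε, CoeffSqLe q ε → CoeffSqLe (p * q) (c * ε) := by
  induction p using Polynomial.induction_on' with
  | add p q hp hq =>
    obtain ⟨c, hc, h⟩ := hp
    obtain ⟨d, hd, h'⟩ := hq
    refine ⟨2 * c + 2 * d, by positivity, fun r ε hr => ?_⟩
    rw [add_mul p q r]
    have := (h r ε hr).add (h' r ε hr)
    intro s
    linarith [this s]
  | monomial k a =>
    refine ⟨‖a‖ ^ 2 + 1, by positivity, fun r ε hr => ?_⟩
    rw [← C_mul_X_pow_eq_monomial, mul_assoc]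
    have := (hr.X_pow_mul k).C_mul a
    have h0 : 0 ≤ ε := by simpa using hr 0
    intro s
    nlinarith [this s]

/-- Multiples of `p` approximate a power of `X` in the `ℓ²` norm of coefficients. -/
def ApproxXPow (p : ℂ[X]) : Prop :=
  ∀ ε : ℝ, 0 < ε → ∃ (q : ℂ[X]) (k : ℕ), CoeffSqLe (X ^ k - p * q) ε

/-- Telescoping: X^(k+l) - pq·ab = X^l (X^k - pa) + pa (X^l - qb). The tolerance for q is chosen
after a, since it must beat the operator norm of multiplication by pa. -/
lemma ApproxXPow.mul {p q : ℂ[X]} (hp : ApproxXPow p) (hq : ApproxXPow q) :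
    ApproxXPow (p * q) := by
  intro ε hε
  obtain ⟨a, k, ha⟩ := hp (ε / 4) (by positivity)
  obtain ⟨c, hc, hmul⟩ := exists_coeffSqLe_mul (p * a)
  obtain ⟨b, l, hb⟩ := hq (ε / (4 * c)) (by positivity)
  refine ⟨a * b, k + l, ?_⟩
  have h1 := (ha.X_pow_mul l).add (hmul _ _ hb)
  have e : X ^ l * (X ^ k - p * a) + p * a * (X ^ l - q * b) = X ^ (k + l) - p * q * (a * b) := by
    ring
  rw [e] at h1
  have e2 : 2 * (ε / 4) + 2 * (c * (ε / (4 * c))) = ε := by field_simp; norm_num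
  rwa [e2] at h1

lemma coeffSqLe_C (a : ℂ) : CoeffSqLe (C a) (‖a‖ ^ 2) := by
  intro s
  calc ∑ i ∈ Finset.range s, ‖(C a).coeff i‖ ^ 2
      = ∑ i ∈ Finset.range s, if i = 0 then ‖a‖ ^ 2 else 0 := by
        refine Finset.sum_congr rfl fun i _ => ?_
        rw [coeff_C]; split_ifs <;> simp
    _ ≤ _ := by rw [Finset.sum_ite_eq']; split_ifs <;> simp

lemma approxXPow_C {a : ℂ} (ha : a ≠ 0) : ApproxXPow (C a) := by
  intro ε hε
  refine ⟨C a⁻¹, 0, fun s => ?_⟩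
  simp [← C_mul, ha, hε.le]

/-- A zero inside the unit disc is handled by X^k - a^k, whose defect a^k is small. A zero on or
outside the circle is handled by an average with value 1 at a, whose k coefficients are at most 1/k
in modulus and so have square sum at most 1/k. On the circle this works in ℓ² although it would fail
in ℓ¹. -/
lemma approxXPow_X_sub_C (a : ℂ) : ApproxXPow (X - C a) := by
  intro ε hε
  rcases lt_or_ge ‖a‖ 1 with ha | ha
  · obtain ⟨k, hk⟩ := exists_pow_lt_of_lt_one hε (show ‖a‖ ^ 2 < 1 by
      nlinarith [norm_nonneg a])
    obtain ⟨q, hq⟩ : X - C a ∣ (X ^ k - C (a ^ k) : ℂ[X]) := by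
      rw [C_pow]; exact sub_dvd_pow_sub_pow _ _ _
    refine ⟨q, k, ?_⟩
    rw [← hq, sub_sub_cancel]
    intro s
    refine (coeffSqLe_C (a ^ k) s).trans ?_
    rw [norm_pow, ← pow_mul, mul_comm, pow_mul]
    exact hk.le
  · have ha0 : a ≠ 0 := by rintro rfl; simp at ha; linarith
    obtain ⟨k, hk⟩ := exists_nat_gt (1 / ε)
    have hk0 : (0 : ℝ) < k := lt_trans (by positivity) hk
    have hkc : (k : ℂ) ≠ 0 := by exact_mod_cast hk0.ne'
    set r : ℂ[X] := ∑ i ∈ Finset.range k, C ((k : ℂ)⁻¹ * (a⁻¹) ^ i) * X ^ i with hr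
    have hcoeff : ∀ j, ‖r.coeff j‖ ^ 2 ≤ if j ∈ Finset.range k then (1 / (k : ℝ)) ^ 2 else 0 := by
      intro j
      rw [hr, finsetSum_coeff]
      simp only [coeff_C_mul_X_pow]
      rw [Finset.sum_ite_eq]
      split_ifs with h
      · rw [norm_mul, norm_pow, norm_inv, norm_inv, Complex.norm_natCast]
        gcongr
        rw [one_div]
        refine mul_le_of_le_one_right (by positivity) (pow_le_one₀ (by positivity) ?_)
        exact inv_le_one_of_one_le₀ ha
      · simp
    -- Divisibility holds because r evaluates to 1 at a.
    obtain ⟨q, hq⟩ : X - C a ∣ (1 - r : ℂ[X]) := by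
      rw [dvd_iff_isRoot, IsRoot, eval_sub, hr, eval_finsetSum]
      simp only [eval_mul, eval_C, eval_pow, eval_X, eval_one, mul_assoc, ← mul_pow,
        inv_mul_cancel₀ ha0, one_pow, mul_one]
      simp [hkc]
    refine ⟨q, 0, ?_⟩
    rw [← hq, pow_zero, sub_sub_cancel]
    intro s
    calc ∑ j ∈ Finset.range s, ‖r.coeff j‖ ^ 2
        ≤ ∑ j ∈ Finset.range s, if j ∈ Finset.range k then (1 / (k : ℝ)) ^ 2 else 0 :=
          Finset.sum_le_sum fun j _ => hcoeff j
      _ ≤ ∑ j ∈ Finset.range k, (1 / (k : ℝ)) ^ 2 := by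
          rw [← Finset.sum_filter]
          refine Finset.sum_le_sum_of_subset_of_nonneg ?_ fun _ _ _ => by positivity
          intro j hj
          exact (Finset.mem_filter.1 hj).2
      _ = 1 / k := by rw [Finset.sum_const, Finset.card_range, nsmul_eq_mul]; field_simp
      _ ≤ ε := by
          rw [div_le_iff₀ hk0]
          rw [div_lt_iff₀ hε] at hk
          linarith

lemma approxXPow_of_ne_zero {p : ℂ[X]} (hp : p ≠ 0) : ApproxXPow p := by
  have h := (IsAlgClosed.splits p).eq_prod_roots
  rw [h]
  refine (approxXPow_C (leadingCoeff_ne_zero.2 hp)).mul ?_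
  refine Multiset.prod_induction ApproxXPow _ (fun _ _ => ApproxXPow.mul) ?_ ?_
  · simpa using approxXPow_C one_ne_zero
  · intro q hq
    obtain ⟨a, -, rfl⟩ := Multiset.mem_map.1 hq
    exact approxXPow_X_sub_C a

/-- Multiples of a nonzero real polynomial approximate a power of `X` in the `ℓ²` norm of
coefficients. -/
lemma exists_X_pow_sub_mul_small {p : ℝ[X]} (hp : p ≠ 0) {ε : ℝ} (hε : 0 < ε) :
    ∃ (q : ℝ[X]) (k : ℕ), ∀ s : ℕ, ∑ i ∈ Finset.range s, ((X ^ k - p * q).coeff i) ^ 2 ≤ ε := by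
  obtain ⟨q, k, h⟩ := approxXPow_of_ne_zero (p := p.map (algebraMap ℝ ℂ))
    (by simpa using (Polynomial.map_ne_zero_iff (algebraMap ℝ ℂ).injective).2 hp) ε hε
  -- Since p is real, taking real parts of the coefficients of q gives the real part of the defect,
  -- which is no larger.
  refine ⟨∑ i ∈ q.support, C (q.coeff i).re * X ^ i, k, fun s => (Finset.sum_le_sum ?_).trans (h s)⟩
  have hq : ∀ j, (∑ i ∈ q.support, C (q.coeff i).re * X ^ i : ℝ[X]).coeff j = (q.coeff j).re := by
    intro j
    rw [finsetSum_coeff]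
    simp only [coeff_C_mul_X_pow]
    rw [Finset.sum_ite_eq]
    split_ifs with hj
    · rfl
    · rw [notMem_support_iff.1 hj]; simp
  intro i _
  have : (X ^ k - p * ∑ i ∈ q.support, C (q.coeff i).re * X ^ i : ℝ[X]).coeff i
      = ((X ^ k - p.map (algebraMap ℝ ℂ) * q).coeff i).re := by
    rw [coeff_sub, coeff_sub, coeff_mul, coeff_mul, Complex.sub_re, Complex.re_sum]
    congr 1
    · rw [coeff_X_pow, coeff_X_pow]; split_ifs <;> simp
    · refine Finset.sum_congr rfl fun x _ => ?_
      rw [hq, coeff_map]; simp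
  rw [this, ← sq_abs]
  gcongr
  exact Complex.abs_re_le_norm _

end

end LQR

namespace LQR

noncomputable section

/-! ### Multiplication of Laurent polynomials in the `ℓ²` norm of coefficients -/

open LaurentPolynomial

/-- The inner product of the coefficient sequences. -/
def ip (p q : ℝ[T;T⁻¹]) : ℝ := (p * invert q).coeff 0

/-- The square sum of the coefficients. -/
def nsq (p : ℝ[T;T⁻¹]) : ℝ := ip p p

lemma ip_comm (p q : ℝ[T;T⁻¹]) : ip p q = ip q p := by
  have h : invert (p * invert q) = q * invert p := by
    rw [map_mul, involutive_invert q, mul_comm]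
  rw [ip, ip, ← h, invert_apply, neg_zero]

lemma ip_add_left (p q r : ℝ[T;T⁻¹]) : ip (p + q) r = ip p r + ip q r := by
  simp [ip, add_mul]

lemma ip_sub_left (p q r : ℝ[T;T⁻¹]) : ip (p - q) r = ip p r - ip q r := by
  simp [ip, sub_mul]

lemma ip_mul_left (a p q : ℝ[T;T⁻¹]) : ip (a * p) q = ip p (invert a * q) := by
  rw [ip, ip, map_mul, involutive_invert a]; congr 2; ring

lemma ip_C_mul_left (a : ℝ) (p q : ℝ[T;T⁻¹]) : ip (C a * p) q = a * ip p q := by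
  rw [ip, ip, mul_assoc, ← smul_eq_C_mul]; simp

lemma ip_eq_sum (p q : ℝ[T;T⁻¹]) : ip p q = p.coeff.sum fun i a => a * q.coeff i := by
  induction p using LaurentPolynomial.induction_on' with
  | add p r hp hr =>
    rw [ip_add_left, hp, hr, AddMonoidAlgebra.coeff_add, Finsupp.sum_add_index']
    · simp
    · intros; ring
  | C_mul_T n a =>
    rw [ip, ← single_eq_C_mul_T, AddMonoidAlgebra.coeff_single, Finsupp.sum_single_index (by simp),
      AddMonoidAlgebra.coeff_single_mul_apply]
    simp

lemma nsq_eq_sum (p : ℝ[T;T⁻¹]) : nsq p = ∑ i ∈ p.coeff.support, p.coeff i ^ 2 := by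
  rw [nsq, ip_eq_sum, Finsupp.sum]
  exact Finset.sum_congr rfl fun i _ => (sq _).symm

lemma nsq_nonneg (p : ℝ[T;T⁻¹]) : 0 ≤ nsq p := by
  rw [nsq_eq_sum]; exact Finset.sum_nonneg fun _ _ => sq_nonneg _

lemma nsq_add (p q : ℝ[T;T⁻¹]) : nsq (p + q) = nsq p + 2 * ip p q + nsq q := by
  rw [nsq, ip_add_left, ip_comm p, ip_comm q, ip_add_left, ip_add_left, ip_comm q p, nsq, nsq]; ring

lemma nsq_sub (p q : ℝ[T;T⁻¹]) : nsq (p - q) = nsq p - 2 * ip p q + nsq q := by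
  rw [nsq, ip_sub_left, ip_comm p, ip_comm q, ip_sub_left, ip_sub_left, ip_comm q p, nsq, nsq]; ring

lemma nsq_add_le (p q : ℝ[T;T⁻¹]) : nsq (p + q) ≤ 2 * nsq p + 2 * nsq q := by
  have h := nsq_nonneg (p - q)
  rw [nsq_sub] at h
  rw [nsq_add]; linarith

lemma nsq_C_mul (a : ℝ) (p : ℝ[T;T⁻¹]) : nsq (C a * p) = a ^ 2 * nsq p := by
  rw [nsq, ip_C_mul_left, ip_comm, ip_C_mul_left, nsq]; ring

lemma nsq_T_mul (k : ℤ) (p : ℝ[T;T⁻¹]) : nsq (T k * p) = nsq p := by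
  rw [nsq, ip_mul_left, invert_T, ← mul_assoc, ← T_add, neg_add_cancel, T_zero, one_mul, nsq]

lemma exists_nsq_mul_le (p : ℝ[T;T⁻¹]) : ∃ c : ℝ, 0 < c ∧ ∀ q, nsq (p * q) ≤ c * nsq q := by
  induction p using LaurentPolynomial.induction_on' with
  | add p q hp hq =>
    obtain ⟨c, hc, h⟩ := hp
    obtain ⟨d, hd, h'⟩ := hq
    refine ⟨2 * c + 2 * d, by positivity, fun r => ?_⟩
    rw [add_mul p q r]
    refine (nsq_add_le _ _).trans ?_
    linarith [h r, h' r]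
  | C_mul_T n a =>
    refine ⟨a ^ 2 + 1, by positivity, fun r => ?_⟩
    rw [mul_assoc, nsq_C_mul, nsq_T_mul]
    nlinarith [nsq_nonneg r]

lemma nsq_toLaurent (f : Polynomial ℝ) :
    nsq (Polynomial.toLaurent f) = ∑ i ∈ f.support, f.coeff i ^ 2 := by
  rw [nsq_eq_sum, support_coeff_toLaurent, Finset.sum_map]
  refine Finset.sum_congr rfl fun i _ => ?_
  rw [coeff_toLaurent]
  congr 1
  exact Finsupp.mapDomain_apply Nat.cast_injective _ _

lemma sum_range_le_nsq (f : Polynomial ℝ) (s : ℕ) :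
    ∑ i ∈ Finset.range s, f.coeff i ^ 2 ≤ nsq (Polynomial.toLaurent f) := by
  rw [nsq_toLaurent, ← Finset.sum_filter_add_sum_filter_not (Finset.range s) (· ∈ f.support)]
  have h : ∑ i ∈ Finset.range s with i ∉ f.support, f.coeff i ^ 2 = 0 := by
    refine Finset.sum_eq_zero fun i hi => ?_
    rw [Polynomial.notMem_support_iff.1 (Finset.mem_filter.1 hi).2]; simp
  rw [h, add_zero]
  exact Finset.sum_le_sum_of_subset_of_nonneg (fun i hi => (Finset.mem_filter.1 hi).2)
    fun _ _ _ => sq_nonneg _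

lemma nsq_le_of_forall {f : Polynomial ℝ} {ε : ℝ}
    (h : ∀ s, ∑ i ∈ Finset.range s, f.coeff i ^ 2 ≤ ε) : nsq (Polynomial.toLaurent f) ≤ ε := by
  rw [nsq_toLaurent]
  refine le_trans ?_ (h (f.natDegree + 1))
  exact Finset.sum_le_sum_of_subset_of_nonneg Polynomial.supp_subset_range_natDegree_succ
    fun _ _ _ => sq_nonneg _

/-! ### A contracting filter close to a pure delay -/

/-- A self-adjoint contraction raised to an even power stays between `0` and `1`. -/
lemma nsq_one_sub_pow_mul_le {D : ℝ[T;T⁻¹]} (hD : invert D = D)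
    (hle : ∀ p, nsq (D * p) ≤ nsq p) (k : ℕ) (p : ℝ[T;T⁻¹]) :
    nsq ((1 - D ^ (2 * k)) * p) ≤ nsq p := by
  have hpow : ∀ (j : ℕ) (p), nsq (D ^ j * p) ≤ nsq p := by
    intro j
    induction j with
    | zero => simp
    | succ j ih =>
      intro p
      rw [pow_succ', mul_assoc]
      exact (hle _).trans (ih p)
  -- The even exponent makes this inner product a square norm, which supplies the sign needed in the
  -- expansion below.
  have h1 : ip p (D ^ (2 * k) * p) = nsq (D ^ k * p) := by
    rw [two_mul, pow_add, mul_assoc, nsq, ip_mul_left, map_pow, hD]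
  have h2 : nsq (D ^ (2 * k) * p) ≤ nsq (D ^ k * p) := by
    rw [two_mul, pow_add, mul_assoc]; exact hpow _ _
  rw [sub_mul, one_mul, nsq_sub, h1]
  linarith [nsq_nonneg (D ^ k * p)]

/-- For a nonzero real polynomial `χ` there is a multiple `χ * p` which, as a filter, is a
contraction of `ℓ²` and is close to a pure delay. -/
lemma exists_filter_laurent {χ : Polynomial ℝ} (hχ : χ ≠ 0) {ε : ℝ} (hε : 0 < ε) :
    ∃ (p : Polynomial ℝ) (N : ℕ),
      (∀ f, nsq (Polynomial.toLaurent (χ * p) * f) ≤ nsq f) ∧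
      nsq (Polynomial.toLaurent (Polynomial.X ^ N - χ * p)) ≤ ε := by
  set g : ℝ[T;T⁻¹] := Polynomial.toLaurent χ with hg
  obtain ⟨c, hc, hcle⟩ := exists_nsq_mul_le (invert g)
  -- `invert` is the ℓ² adjoint, so D is self-adjoint. The factor c⁻¹ keeps its quadratic form
  -- between 0 and 1.
  set D : ℝ[T;T⁻¹] := 1 - C c⁻¹ * (g * invert g) with hDdef
  have hDinv : invert D = D := by
    rw [hDdef, map_sub, map_mul, map_mul, map_one, invert_C, involutive_invert g,
      mul_comm g (invert g)]
  -- The cross term contributes -2c⁻¹ and the square at most +c⁻¹ times `nsq (g * p)`, so D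
  -- decreases the norm by a controlled amount.
  have hstep : ∀ p, nsq (D * p) ≤ nsq p - c⁻¹ * nsq (g * p) := by
    intro p
    have e : D * p = p - C c⁻¹ * (invert g * (g * p)) := by rw [hDdef]; ring
    have e1 : ip p (C c⁻¹ * (invert g * (g * p))) = c⁻¹ * nsq (g * p) := by
      rw [ip_comm, ip_C_mul_left, ip_comm, nsq, ip_mul_left g p]
    rw [e, nsq_sub, e1, nsq_C_mul]
    have h := hcle (g * p)
    have : c⁻¹ ^ 2 * nsq (invert g * (g * p)) ≤ c⁻¹ ^ 2 * (c * nsq (g * p)) := by gcongr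
    have e2 : c⁻¹ ^ 2 * (c * nsq (g * p)) = c⁻¹ * nsq (g * p) := by field_simp
    linarith
  have hle : ∀ p, nsq (D * p) ≤ nsq p := fun p =>
    (hstep p).trans (by have := nsq_nonneg (g * p); have := inv_pos.2 hc; nlinarith)
  -- The norms of D^k p decrease to a limit, and by `hstep` each decrement dominates the norm of D^k
  -- g p up to the factor c. Hence D^k tends to 0 on multiples of g.
  have hlim : ∀ p, Tendsto (fun k : ℕ => nsq (D ^ k * (g * p))) atTop (𝓝 0) := by
    intro p
    have hanti : Antitone fun k : ℕ => nsq (D ^ k * p) := by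
      refine antitone_nat_of_succ_le fun k => ?_
      rw [pow_succ', mul_assoc]; exact hle _
    have hconv := tendsto_atTop_ciInf hanti
      ⟨0, by rintro _ ⟨k, rfl⟩; exact nsq_nonneg _⟩
    have hdiff := (hconv.sub (hconv.comp (tendsto_add_atTop_nat 1))).const_mul c
    rw [sub_self, mul_zero] at hdiff
    refine squeeze_zero (fun k => nsq_nonneg _) (fun k => ?_) hdiff
    have h := hstep (D ^ k * p)
    have e : D ^ k * (g * p) = g * (D ^ k * p) := by ring
    rw [e]
    simp only [Function.comp_apply]
    rw [pow_succ', mul_assoc]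
    have : c * (c⁻¹ * nsq (g * (D ^ k * p))) ≤ c * (nsq (D ^ k * p) - nsq (D * (D ^ k * p))) := by
      gcongr; linarith
    rwa [← mul_assoc, mul_inv_cancel₀ hc.ne', one_mul] at this
  have hpow : ∀ (j : ℕ) (p), nsq (D ^ j * p) ≤ nsq p := by
    intro j
    induction j with
    | zero => simp
    | succ j ih =>
      intro p
      rw [pow_succ', mul_assoc]
      exact (hle _).trans (ih p)
  -- A power of X is nearly a multiple of g, so D^k also becomes small on it. A shift does not
  -- change the norm, so D^k itself becomes small.
  obtain ⟨q, l, hq⟩ := exists_X_pow_sub_mul_small hχ (show 0 < ε / 4 by positivity)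
  have hq' := nsq_le_of_forall hq
  obtain ⟨k, hk⟩ := ((hlim (Polynomial.toLaurent q)).eventually
    (gt_mem_nhds (show 0 < ε / 4 by positivity))).exists
  have hsmall : nsq (D ^ (2 * k)) ≤ ε := by
    have h1 : nsq (D ^ (2 * k)) ≤ nsq (D ^ k) := by
      rw [two_mul, pow_add]; exact hpow _ _
    have h2 : nsq (D ^ k) = nsq (D ^ k * Polynomial.toLaurent (Polynomial.X ^ l)) := by
      rw [Polynomial.toLaurent_X_pow, mul_comm, nsq_T_mul]
    have h3 : D ^ k * Polynomial.toLaurent (Polynomial.X ^ l)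
        = D ^ k * (g * Polynomial.toLaurent q)
          + D ^ k * Polynomial.toLaurent (Polynomial.X ^ l - χ * q) := by
      rw [map_sub, map_mul, ← hg]; ring
    rw [h3] at h2
    have h4 := nsq_add_le (D ^ k * (g * Polynomial.toLaurent q))
      (D ^ k * Polynomial.toLaurent (Polynomial.X ^ l - χ * q))
    have h5 := hpow k (Polynomial.toLaurent (Polynomial.X ^ l - χ * q))
    linarith
  obtain ⟨r, hr⟩ : g ∣ 1 - D ^ (2 * k) := by
    have h1 : (1 - D) ∣ 1 - D ^ (2 * k) := by simpa using sub_dvd_pow_sub_pow 1 D (2 * k)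
    refine dvd_trans ⟨C c⁻¹ * invert g, ?_⟩ h1
    rw [hDdef]; ring
  -- The delay N clears the negative powers of the Laurent quotient and makes the filter causal.
  obtain ⟨N, p, hp⟩ := exists_T_pow r
  have hm : Polynomial.toLaurent (χ * p) = T (N : ℤ) * (1 - D ^ (2 * k)) := by
    rw [map_mul, hp, hr, ← hg]; ring
  refine ⟨p, N, fun f => ?_, ?_⟩
  · rw [hm, mul_assoc, nsq_T_mul]
    exact nsq_one_sub_pow_mul_le hDinv hle k f
  · rw [map_sub, Polynomial.toLaurent_X_pow, hm]
    have : T (N : ℤ) - T (N : ℤ) * (1 - D ^ (2 * k)) = T (N : ℤ) * D ^ (2 * k) := by ring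
    rw [this, nsq_T_mul]
    exact hsmall

/-! ### Polynomial filters on power series -/

/-- A polynomial filter acts on sequences, written as power series, through their initial
segments. -/
lemma coeff_mul_trunc (m : Polynomial ℝ) (f : PowerSeries ℝ) {s t : ℕ} (h : t < s) :
    PowerSeries.coeff t ((m : PowerSeries ℝ) * f) = (m * PowerSeries.trunc s f).coeff t := by
  rw [PowerSeries.coeff_mul, Polynomial.coeff_mul]
  refine Finset.sum_congr rfl fun x hx => ?_
  have hx' : x.2 ≤ t := by rw [Finset.HasAntidiagonal.mem_antidiagonal] at hx; omega
  rw [Polynomial.coeff_coe, PowerSeries.coeff_trunc, if_pos (lt_of_le_of_lt hx' h)]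

lemma nsq_trunc_le (f : PowerSeries ℝ) (s : ℕ) :
    nsq (Polynomial.toLaurent (PowerSeries.trunc s f))
      ≤ ∑ t ∈ Finset.range s, PowerSeries.coeff t f ^ 2 := by
  refine nsq_le_of_forall fun r => ?_
  calc ∑ i ∈ Finset.range r, (PowerSeries.trunc s f).coeff i ^ 2
      = ∑ i ∈ Finset.range r with i < s, PowerSeries.coeff i f ^ 2 := by
        rw [Finset.sum_filter]
        refine Finset.sum_congr rfl fun i _ => ?_
        rw [PowerSeries.coeff_trunc]; split_ifs <;> simp
    _ ≤ _ := Finset.sum_le_sum_of_subset_of_nonneg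
        (fun i hi => Finset.mem_range.2 (Finset.mem_filter.1 hi).2) fun _ _ _ => sq_nonneg _

/-- A polynomial filter is causal: outputs before time s see only inputs before time s. The Laurent
estimate can therefore be applied to the truncated input. -/
lemma exists_filter {χ : Polynomial ℝ} (hχ : χ ≠ 0) {ε : ℝ} (hε : 0 < ε) :
    ∃ (p : Polynomial ℝ) (N : ℕ),
      (∀ (f : PowerSeries ℝ) (s : ℕ),
        ∑ t ∈ Finset.range s, PowerSeries.coeff t (((χ * p : Polynomial ℝ) : PowerSeries ℝ) * f) ^ 2
          ≤ ∑ t ∈ Finset.range s, PowerSeries.coeff t f ^ 2) ∧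
      ∀ s : ℕ, ∑ t ∈ Finset.range s, (Polynomial.X ^ N - χ * p).coeff t ^ 2 ≤ ε := by
  obtain ⟨p, N, h1, h2⟩ := exists_filter_laurent hχ hε
  refine ⟨p, N, fun f s => ?_, fun s => (sum_range_le_nsq _ s).trans h2⟩
  have e : ∑ t ∈ Finset.range s,
      PowerSeries.coeff t (((χ * p : Polynomial ℝ) : PowerSeries ℝ) * f) ^ 2
      = ∑ t ∈ Finset.range s, (χ * p * PowerSeries.trunc s f).coeff t ^ 2 :=
    Finset.sum_congr rfl fun t ht => by rw [coeff_mul_trunc _ _ (Finset.mem_range.1 ht)]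
  rw [e]
  refine (sum_range_le_nsq _ s).trans ?_
  rw [map_mul]
  exact (h1 _).trans (nsq_trunc_le f s)

/-- A polynomial filter is bounded on `ℓ²`. -/
lemma exists_filter_bound (p : Polynomial ℝ) :
    ∃ c : ℝ, 0 < c ∧ ∀ (f : PowerSeries ℝ) (s : ℕ),
      ∑ t ∈ Finset.range s, PowerSeries.coeff t ((p : PowerSeries ℝ) * f) ^ 2
        ≤ c * ∑ t ∈ Finset.range s, PowerSeries.coeff t f ^ 2 := by
  obtain ⟨c, hc, h⟩ := exists_nsq_mul_le (Polynomial.toLaurent p)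
  refine ⟨c, hc, fun f s => ?_⟩
  have e : ∑ t ∈ Finset.range s, PowerSeries.coeff t ((p : PowerSeries ℝ) * f) ^ 2
      = ∑ t ∈ Finset.range s, (p * PowerSeries.trunc s f).coeff t ^ 2 :=
    Finset.sum_congr rfl fun t ht => by rw [coeff_mul_trunc _ _ (Finset.mem_range.1 ht)]
  rw [e]
  refine (sum_range_le_nsq _ s).trans ?_
  rw [map_mul]
  exact (h _).trans (mul_le_mul_of_nonneg_left (nsq_trunc_le f s) hc.le)

end

end LQR

namespace LQR

noncomputable section

/-! ### Quadratic forms -/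

lemma mulVec_transpose_dotProduct {n m : ℕ} (B : Matrix (Fin n) (Fin m) ℝ) (a : Fin n → ℝ)
    (u : Fin m → ℝ) : (Bᵀ *ᵥ a) ⬝ᵥ u = a ⬝ᵥ B *ᵥ u := by
  rw [mulVec_transpose, dotProduct_mulVec]

lemma dotProduct_mulVec_symm {n : ℕ} {P : Matrix (Fin n) (Fin n) ℝ} (hP : Pᵀ = P)
    (a b : Fin n → ℝ) : a ⬝ᵥ P *ᵥ b = b ⬝ᵥ P *ᵥ a := by
  rw [← mulVec_transpose_dotProduct, hP, dotProduct_comm]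

lemma _root_.Matrix.PosSemidef.transpose_eq {n : ℕ} {P : Matrix (Fin n) (Fin n) ℝ}
    (hP : P.PosSemidef) : Pᵀ = P := by
  simpa [IsHermitian, conjTranspose_eq_transpose_of_trivial] using hP.isHermitian

lemma _root_.Matrix.PosSemidef.form_nonneg {n : ℕ} {P : Matrix (Fin n) (Fin n) ℝ}
    (hP : P.PosSemidef) (x : Fin n → ℝ) : 0 ≤ x ⬝ᵥ P *ᵥ x := by
  simpa using hP.dotProduct_mulVec_nonneg x

lemma _root_.Matrix.PosDef.form_eq_zero {n : ℕ} {P : Matrix (Fin n) (Fin n) ℝ}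
    (hP : P.PosDef) {x : Fin n → ℝ} (h : x ⬝ᵥ P *ᵥ x = 0) : x = 0 := by
  by_contra hx
  have := hP.dotProduct_mulVec_pos hx
  simp [h] at this

lemma posSemidef_of_form {n : ℕ} {P : Matrix (Fin n) (Fin n) ℝ} (hP : Pᵀ = P)
    (h : ∀ x, 0 ≤ x ⬝ᵥ P *ᵥ x) : P.PosSemidef :=
  .of_dotProduct_mulVec_nonneg (by rw [IsHermitian, conjTranspose_eq_transpose_of_trivial, hP])
    fun x => by simpa using h x

/-- Young's inequality for a positive semidefinite form. -/
lemma _root_.Matrix.PosSemidef.form_add_le {n : ℕ} {P : Matrix (Fin n) (Fin n) ℝ}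
    (hP : P.PosSemidef) {θ : ℝ} (hθ : 0 < θ) (x y : Fin n → ℝ) :
    (x + y) ⬝ᵥ P *ᵥ (x + y) ≤ (1 + θ) * (x ⬝ᵥ P *ᵥ x) + (1 + θ⁻¹) * (y ⬝ᵥ P *ᵥ y) := by
  have h := hP.form_nonneg (θ • x - y)
  have hs := dotProduct_mulVec_symm hP.transpose_eq x y
  simp only [mulVec_sub, mulVec_smul, dotProduct_sub, sub_dotProduct, smul_dotProduct,
    dotProduct_smul, smul_eq_mul, ← hs] at h
  simp only [mulVec_add, dotProduct_add, add_dotProduct, ← hs]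
  have h2 : 0 ≤ θ⁻¹ * (θ * (θ * x ⬝ᵥ P *ᵥ x) - θ * x ⬝ᵥ P *ᵥ y
      - (θ * x ⬝ᵥ P *ᵥ y - y ⬝ᵥ P *ᵥ y)) := mul_nonneg (by positivity) (by linarith)
  have e : θ⁻¹ * (θ * (θ * x ⬝ᵥ P *ᵥ x) - θ * x ⬝ᵥ P *ᵥ y
      - (θ * x ⬝ᵥ P *ᵥ y - y ⬝ᵥ P *ᵥ y)) =
      θ * (x ⬝ᵥ P *ᵥ x) - 2 * (x ⬝ᵥ P *ᵥ y) + θ⁻¹ * (y ⬝ᵥ P *ᵥ y) := by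
    field_simp; ring
  rw [e] at h2
  linarith

lemma posDef_add_form {n m : ℕ} {R : Matrix (Fin m) (Fin m) ℝ} (hR : R.PosDef)
    {P : Matrix (Fin n) (Fin n) ℝ} (hP : P.PosSemidef) (B : Matrix (Fin n) (Fin m) ℝ) :
    (R + Bᵀ * P * B).PosDef := by
  have := hP.conjTranspose_mul_mul_same B
  rw [conjTranspose_eq_transpose_of_trivial] at this
  exact hR.add_posSemidef this

lemma complete_square {m : ℕ} {M : Matrix (Fin m) (Fin m) ℝ} (hM : M.PosDef)
    (u b : Fin m → ℝ) :
    u ⬝ᵥ M *ᵥ u + 2 * (u ⬝ᵥ b)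
      = (u + M⁻¹ *ᵥ b) ⬝ᵥ M *ᵥ (u + M⁻¹ *ᵥ b) - b ⬝ᵥ M⁻¹ *ᵥ b := by
  have hu : M * M⁻¹ = 1 := mul_nonsing_inv _ ((isUnit_iff_isUnit_det _).1 hM.isUnit)
  have h1 : M *ᵥ (M⁻¹ *ᵥ b) = b := by rw [mulVec_mulVec, hu, one_mulVec]
  have h2 : (M⁻¹ *ᵥ b) ⬝ᵥ M *ᵥ u = u ⬝ᵥ b := by
    rw [dotProduct_mulVec_symm hM.posSemidef.transpose_eq, h1]
  simp only [mulVec_add, dotProduct_add, add_dotProduct, h1, h2, dotProduct_comm _ b]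
  ring

/-! ### Dynamic programming for a fixed noise sequence -/

variable {n m : ℕ} (A : Matrix (Fin n) (Fin n) ℝ) (B : Matrix (Fin n) (Fin m) ℝ)
    (Q : Matrix (Fin n) (Fin n) ℝ) (R : Matrix (Fin m) (Fin m) ℝ)
    (Qf : Matrix (Fin n) (Fin n) ℝ)

/-- The closed loop matrix `A - B K`. -/
def closedLoop (P : Matrix (Fin n) (Fin n) ℝ) : Matrix (Fin n) (Fin n) ℝ :=
  A - B * kalmanGain A B R P

/-- One step of the Riccati recursion. -/
def riccatiStep (P : Matrix (Fin n) (Fin n) ℝ) : Matrix (Fin n) (Fin n) ℝ :=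
  Q + Aᵀ * P * A - Aᵀ * P * B * (R + Bᵀ * P * B)⁻¹ * Bᵀ * P * A

/-- The optimal correction `M⁻¹ Bᵀ (P (A x + w) + v)` of one step. -/
def stepControl (P : Matrix (Fin n) (Fin n) ℝ) (v w x : Fin n → ℝ) : Fin m → ℝ :=
  (R + Bᵀ * P * B)⁻¹ *ᵥ (Bᵀ *ᵥ (P *ᵥ (A *ᵥ x + w) + v))

/-- The optimal cost of one step, apart from the terms which depend on the state. -/
def stepCost (P : Matrix (Fin n) (Fin n) ℝ) (v w : Fin n → ℝ) : ℝ :=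
  w ⬝ᵥ P *ᵥ w + 2 * (v ⬝ᵥ w)
    - (Bᵀ *ᵥ (P *ᵥ w + v)) ⬝ᵥ (R + Bᵀ * P * B)⁻¹ *ᵥ (Bᵀ *ᵥ (P *ᵥ w + v))

/-- Completion of squares in one step of dynamic programming. -/
lemma step_identity (hR : R.PosDef) {P : Matrix (Fin n) (Fin n) ℝ} (hP : P.PosSemidef)
    (v w x : Fin n → ℝ) (u : Fin m → ℝ) :
    (x ⬝ᵥ Q *ᵥ x + u ⬝ᵥ R *ᵥ u)
        + ((A *ᵥ x + B *ᵥ u + w) ⬝ᵥ P *ᵥ (A *ᵥ x + B *ᵥ u + w)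
          + 2 * (v ⬝ᵥ (A *ᵥ x + B *ᵥ u + w)))
      = x ⬝ᵥ riccatiStep A B Q R P *ᵥ x
        + 2 * (((closedLoop A B R P)ᵀ *ᵥ (P *ᵥ w + v)) ⬝ᵥ x)
        + stepCost B R P v w
        + (u + stepControl A B R P v w x) ⬝ᵥ
            (R + Bᵀ * P * B) *ᵥ (u + stepControl A B R P v w x) := by
  have hM := posDef_add_form hR hP B
  set M := R + Bᵀ * P * B with hMdef
  have hPs := hP.transpose_eq
  have hMi : (M⁻¹)ᵀ = M⁻¹ := hM.inv.posSemidef.transpose_eq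
  have hsq := complete_square hM u (Bᵀ *ᵥ (P *ᵥ (A *ᵥ x + w) + v))
  have hMu : u ⬝ᵥ M *ᵥ u = u ⬝ᵥ R *ᵥ u + (B *ᵥ u) ⬝ᵥ P *ᵥ (B *ᵥ u) := by
    rw [hMdef, add_mulVec, dotProduct_add, ← mulVec_mulVec, ← mulVec_mulVec,
      ← mulVec_transpose_dotProduct Bᵀ, transpose_transpose]
  have hub : u ⬝ᵥ (Bᵀ *ᵥ (P *ᵥ (A *ᵥ x + w) + v))
      = (A *ᵥ x + w) ⬝ᵥ P *ᵥ (B *ᵥ u) + v ⬝ᵥ (B *ᵥ u) := by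
    rw [dotProduct_comm, mulVec_transpose_dotProduct, add_dotProduct, dotProduct_comm (P *ᵥ _),
      dotProduct_mulVec_symm hPs]
  have hb : Bᵀ *ᵥ (P *ᵥ (A *ᵥ x + w) + v) = Bᵀ *ᵥ (P *ᵥ (A *ᵥ x)) + Bᵀ *ᵥ (P *ᵥ w + v) := by
    simp only [mulVec_add, add_assoc]
  have hric : x ⬝ᵥ riccatiStep A B Q R P *ᵥ x = x ⬝ᵥ Q *ᵥ x + (A *ᵥ x) ⬝ᵥ P *ᵥ (A *ᵥ x)
      - (Bᵀ *ᵥ (P *ᵥ (A *ᵥ x))) ⬝ᵥ M⁻¹ *ᵥ (Bᵀ *ᵥ (P *ᵥ (A *ᵥ x))) := by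
    rw [riccatiStep, ← hMdef, sub_mulVec, add_mulVec, dotProduct_sub, dotProduct_add]
    simp only [← mulVec_mulVec]
    rw [← mulVec_transpose_dotProduct Aᵀ, transpose_transpose,
      ← mulVec_transpose_dotProduct Aᵀ, transpose_transpose,
      ← mulVec_transpose_dotProduct P _ (B *ᵥ _), hPs, ← mulVec_transpose_dotProduct B]
  have hL : ((closedLoop A B R P)ᵀ *ᵥ (P *ᵥ w + v)) ⬝ᵥ x
      = (A *ᵥ x) ⬝ᵥ P *ᵥ w + v ⬝ᵥ (A *ᵥ x)
        - (Bᵀ *ᵥ (P *ᵥ (A *ᵥ x))) ⬝ᵥ M⁻¹ *ᵥ (Bᵀ *ᵥ (P *ᵥ w + v)) := by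
    rw [mulVec_transpose_dotProduct, closedLoop, kalmanGain, ← hMdef, sub_mulVec, dotProduct_sub]
    simp only [← mulVec_mulVec]
    rw [add_dotProduct, dotProduct_comm (P *ᵥ w), ← mulVec_transpose_dotProduct B,
      dotProduct_mulVec_symm hMi]
  rw [hb] at hsq
  rw [hric, hL, stepCost, stepControl, ← hMdef, hb]
  rw [hMu, ← hb, hub, hb] at hsq
  have hs1 := dotProduct_mulVec_symm hMi (Bᵀ *ᵥ (P *ᵥ (A *ᵥ x))) (Bᵀ *ᵥ (P *ᵥ w + v))
  have hs2 := dotProduct_mulVec_symm hPs (B *ᵥ u) (A *ᵥ x)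
  have hs3 := dotProduct_mulVec_symm hPs (B *ᵥ u) w
  have hs4 := dotProduct_mulVec_symm hPs w (A *ᵥ x)
  have e : (Bᵀ *ᵥ (P *ᵥ (A *ᵥ x)) + Bᵀ *ᵥ (P *ᵥ w + v)) ⬝ᵥ
      M⁻¹ *ᵥ (Bᵀ *ᵥ (P *ᵥ (A *ᵥ x)) + Bᵀ *ᵥ (P *ᵥ w + v))
      = (Bᵀ *ᵥ (P *ᵥ (A *ᵥ x))) ⬝ᵥ M⁻¹ *ᵥ (Bᵀ *ᵥ (P *ᵥ (A *ᵥ x)))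
        + 2 * ((Bᵀ *ᵥ (P *ᵥ (A *ᵥ x))) ⬝ᵥ M⁻¹ *ᵥ (Bᵀ *ᵥ (P *ᵥ w + v)))
        + (Bᵀ *ᵥ (P *ᵥ w + v)) ⬝ᵥ M⁻¹ *ᵥ (Bᵀ *ᵥ (P *ᵥ w + v)) := by
    rw [mulVec_add M⁻¹, dotProduct_add, add_dotProduct, add_dotProduct, ← hs1]; ring
  rw [e] at hsq
  have e1 : (A *ᵥ x + B *ᵥ u + w) ⬝ᵥ P *ᵥ (A *ᵥ x + B *ᵥ u + w)
      = (A *ᵥ x) ⬝ᵥ P *ᵥ (A *ᵥ x) + (B *ᵥ u) ⬝ᵥ P *ᵥ (B *ᵥ u) + w ⬝ᵥ P *ᵥ w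
        + 2 * ((A *ᵥ x) ⬝ᵥ P *ᵥ (B *ᵥ u)) + 2 * ((A *ᵥ x) ⬝ᵥ P *ᵥ w)
        + 2 * (w ⬝ᵥ P *ᵥ (B *ᵥ u)) := by
    generalize A *ᵥ x = a at *
    generalize B *ᵥ u = b at *
    simp only [mulVec_add P, dotProduct_add, add_dotProduct]
    linarith
  rw [e1, dotProduct_add, dotProduct_add]
  rw [add_dotProduct (A *ᵥ x) w] at hsq
  linarith

/-- With no noise and no linear term, the new form at x is the one-step cost of the minimizing
control, which is a sum of nonnegative terms. -/
lemma riccatiStep_posSemidef (hQ : Q.PosSemidef) (hR : R.PosDef) {P : Matrix (Fin n) (Fin n) ℝ}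
    (hP : P.PosSemidef) : (riccatiStep A B Q R P).PosSemidef := by
  have hM := posDef_add_form hR hP B
  refine posSemidef_of_form ?_ fun x => ?_
  · have hMi := hM.inv.posSemidef.transpose_eq
    rw [Matrix.mul_assoc] at hMi
    simp only [riccatiStep, transpose_sub, transpose_add, transpose_mul, transpose_transpose,
      hQ.transpose_eq, hP.transpose_eq, hMi, Matrix.mul_assoc]
  · have h := step_identity A B Q R hR hP 0 0 x (-stepControl A B R P 0 0 x)
    simp only [stepCost, mulVec_zero, dotProduct_zero, zero_dotProduct, add_zero, mul_zero,
      sub_zero, neg_add_cancel] at h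
    rw [← h]
    have h1 := hQ.form_nonneg x
    have h2 := hR.posSemidef.form_nonneg (-stepControl A B R P 0 0 x)
    have h3 := hP.form_nonneg (A *ᵥ x + B *ᵥ (-stepControl A B R P 0 0 x))
    linarith

/-- The Riccati iterates, indexed by the number of steps to go. -/
def riccatiIter : ℕ → Matrix (Fin n) (Fin n) ℝ
  | 0 => Qf
  | k + 1 => riccatiStep A B Q R (riccatiIter k)

lemma riccatiIter_posSemidef (hQ : Q.PosSemidef) (hR : R.PosDef) (hQf : Qf.PosSemidef) (k : ℕ) :
    (riccatiIter A B Q R Qf k).PosSemidef := by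
  induction k with
  | zero => exact hQf
  | succ k ih => exact riccatiStep_posSemidef A B Q R hQ hR ih

/-- The linear part of the value function with `k` steps to go. -/
def costate (T : ℕ) (w : ℕ → Fin n → ℝ) : ℕ → Fin n → ℝ
  | 0 => 0
  | k + 1 => (closedLoop A B R (riccatiIter A B Q R Qf k))ᵀ *ᵥ
      (riccatiIter A B Q R Qf k *ᵥ w (T - 1 - k) + costate T w k)

/-- The optimal feedback (up to sign) with `k + 1` steps to go. -/
def feedback (T : ℕ) (w : ℕ → Fin n → ℝ) (k : ℕ) (x : Fin n → ℝ) : Fin m → ℝ :=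
  stepControl A B R (riccatiIter A B Q R Qf k) (costate A B Q R Qf T w k) (w (T - 1 - k)) x

/-- The minimal total cost. -/
def optValue (T : ℕ) (w : ℕ → Fin n → ℝ) : ℝ :=
  ∑ t ∈ Finset.range T, stepCost B R (riccatiIter A B Q R Qf (T - 1 - t))
    (costate A B Q R Qf T w (T - 1 - t)) (w t)

/-- The total cost exceeds the optimal value by a sum of squares. -/
lemma totalCost_eq (hQ : Q.PosSemidef) (hR : R.PosDef) (hQf : Qf.PosSemidef) (T : ℕ)
    (w : ℕ → Fin n → ℝ) (u : ℕ → Fin m → ℝ) :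
    totalCost A B Q R Qf T w u = optValue A B Q R Qf T w
      + ∑ t ∈ Finset.range T,
        (u t + feedback A B Q R Qf T w (T - 1 - t) (state A B w u t)) ⬝ᵥ
          (R + Bᵀ * riccatiIter A B Q R Qf (T - 1 - t) * B) *ᵥ
          (u t + feedback A B Q R Qf T w (T - 1 - t) (state A B w u t)) := by
  -- Forward telescoping: the cost already paid plus the state-dependent part of the cost-to-go
  -- changes at each step only by `stepCost` and a square. At t = 0 the state vanishes; at t = T the
  -- weight is Qf and the linear part is 0.
  have key : ∀ t ≤ T,
      runningCost A B Q R t w u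
        + (state A B w u t ⬝ᵥ riccatiIter A B Q R Qf (T - t) *ᵥ state A B w u t
          + 2 * (costate A B Q R Qf T w (T - t) ⬝ᵥ state A B w u t))
      = ∑ s ∈ Finset.range t, stepCost B R (riccatiIter A B Q R Qf (T - 1 - s))
          (costate A B Q R Qf T w (T - 1 - s)) (w s)
        + ∑ s ∈ Finset.range t,
        (u s + feedback A B Q R Qf T w (T - 1 - s) (state A B w u s)) ⬝ᵥ
          (R + Bᵀ * riccatiIter A B Q R Qf (T - 1 - s) * B) *ᵥ
          (u s + feedback A B Q R Qf T w (T - 1 - s) (state A B w u s)) := by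
    intro t
    induction t with
    | zero => intro _; simp [runningCost, state]
    | succ t ih =>
      intro ht
      have h := step_identity A B Q R hR
        (riccatiIter_posSemidef A B Q R Qf hQ hR hQf (T - 1 - t))
        (costate A B Q R Qf T w (T - 1 - t)) (w t) (state A B w u t) (u t)
      have e : T - t = (T - 1 - t) + 1 := by omega
      have e' : T - (t + 1) = T - 1 - t := by omega
      have e'' : T - 1 - (T - 1 - t) = t := by omega
      have ih' := ih (by omega)
      rw [e] at ih'
      simp only [riccatiIter, costate, e''] at ih'
      rw [runningCost, Finset.sum_range_succ, Finset.sum_range_succ, Finset.sum_range_succ]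
      rw [runningCost] at ih'
      rw [e']
      have hf : feedback A B Q R Qf T w (T - 1 - t) (state A B w u t)
          = stepControl A B R (riccatiIter A B Q R Qf (T - 1 - t))
            (costate A B Q R Qf T w (T - 1 - t)) (w t) (state A B w u t) := by
        rw [feedback, e'']
      rw [hf]
      simp only [state]
      linarith
  have h := key T le_rfl
  simp only [Nat.sub_self, riccatiIter, costate, zero_dotProduct, mul_zero, add_zero] at h
  rw [totalCost, h, optValue]

lemma optValue_le_totalCost (hQ : Q.PosSemidef) (hR : R.PosDef) (hQf : Qf.PosSemidef) (T : ℕ)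
    (w : ℕ → Fin n → ℝ) (u : ℕ → Fin m → ℝ) :
    optValue A B Q R Qf T w ≤ totalCost A B Q R Qf T w u := by
  rw [totalCost_eq A B Q R Qf hQ hR hQf]
  refine le_add_of_nonneg_right (Finset.sum_nonneg fun t _ => ?_)
  exact (posDef_add_form hR (riccatiIter_posSemidef A B Q R Qf hQ hR hQf _) B).posSemidef.form_nonneg
    _

/-- The optimal trajectory. -/
def optState (T : ℕ) (w : ℕ → Fin n → ℝ) : ℕ → Fin n → ℝ
  | 0 => 0
  | t + 1 => A *ᵥ optState T w t
      + B *ᵥ (-feedback A B Q R Qf T w (T - 1 - t) (optState T w t)) + w t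

/-- The optimal controls. -/
def optControl (T : ℕ) (w : ℕ → Fin n → ℝ) (t : ℕ) : Fin m → ℝ :=
  -feedback A B Q R Qf T w (T - 1 - t) (optState A B Q R Qf T w t)

lemma state_optControl (T : ℕ) (w : ℕ → Fin n → ℝ) (t : ℕ) :
    state A B w (optControl A B Q R Qf T w) t = optState A B Q R Qf T w t := by
  induction t with
  | zero => rfl
  | succ t ih => rw [state, ih, optState, optControl]

lemma totalCost_optControl (hQ : Q.PosSemidef) (hR : R.PosDef) (hQf : Qf.PosSemidef) (T : ℕ)
    (w : ℕ → Fin n → ℝ) :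
    totalCost A B Q R Qf T w (optControl A B Q R Qf T w) = optValue A B Q R Qf T w := by
  rw [totalCost_eq A B Q R Qf hQ hR hQf]
  refine add_eq_left.2 (Finset.sum_eq_zero fun t _ => ?_)
  rw [state_optControl, optControl, neg_add_cancel, zero_dotProduct]

lemma isOptimalOffline_optControl (hQ : Q.PosSemidef) (hR : R.PosDef) (hQf : Qf.PosSemidef)
    (T : ℕ) (w : ℕ → Fin n → ℝ) :
    IsOptimalOffline A B Q R Qf T w (optControl A B Q R Qf T w) := fun u' => by
  rw [totalCost_optControl A B Q R Qf hQ hR hQf]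
  exact optValue_le_totalCost A B Q R Qf hQ hR hQf T w u'

variable {A B Q R Qf} in
lemma IsOptimalOffline.totalCost_eq_optValue (hQ : Q.PosSemidef) (hR : R.PosDef)
    (hQf : Qf.PosSemidef) {T : ℕ} {w : ℕ → Fin n → ℝ} {u : ℕ → Fin m → ℝ}
    (h : IsOptimalOffline A B Q R Qf T w u) :
    totalCost A B Q R Qf T w u = optValue A B Q R Qf T w :=
  le_antisymm ((h _).trans_eq (totalCost_optControl A B Q R Qf hQ hR hQf T w))
    (optValue_le_totalCost A B Q R Qf hQ hR hQf T w u)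

variable {A B Q R Qf} in
/-- Optimal controls are unique, and so is the optimal trajectory. -/
lemma IsOptimalOffline.eq_opt (hQ : Q.PosSemidef) (hR : R.PosDef)
    (hQf : Qf.PosSemidef) {T : ℕ} {w : ℕ → Fin n → ℝ} {u : ℕ → Fin m → ℝ}
    (h : IsOptimalOffline A B Q R Qf T w u) :
    (∀ t < T, u t = optControl A B Q R Qf T w t) ∧
      ∀ t ≤ T, state A B w u t = optState A B Q R Qf T w t := by
  have h0 := h.totalCost_eq_optValue hQ hR hQf
  rw [totalCost_eq A B Q R Qf hQ hR hQf, add_eq_left] at h0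
  have hpd := fun k => posDef_add_form hR (riccatiIter_posSemidef A B Q R Qf hQ hR hQf k) B
  have hu : ∀ t < T, u t = -feedback A B Q R Qf T w (T - 1 - t) (state A B w u t) := by
    intro t ht
    rw [Finset.sum_eq_zero_iff_of_nonneg fun t _ => (hpd _).posSemidef.form_nonneg _] at h0
    exact eq_neg_of_add_eq_zero_left ((hpd _).form_eq_zero (h0 t (Finset.mem_range.2 ht)))
  have hx : ∀ t ≤ T, state A B w u t = optState A B Q R Qf T w t := by
    intro t
    induction t with
    | zero => intro _; rfl
    | succ t ih =>
      intro ht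
      rw [state, optState, hu t ht, ih (by omega)]
  exact ⟨fun t ht => by rw [hu t ht, hx t ht.le, optControl], hx⟩

/-! ### Superposition and comparison of costs -/

lemma state_add (w w' : ℕ → Fin n → ℝ) (u u' : ℕ → Fin m → ℝ) (t : ℕ) :
    state A B (w + w') (u + u') t = state A B w u t + state A B w' u' t := by
  induction t with
  | zero => simp [state]
  | succ t ih =>
    simp only [state, ih, Pi.add_apply, mulVec_add]
    abel

/-- Young's inequality for the total cost of superposed trajectories. -/
lemma totalCost_add_le (hQ : Q.PosSemidef) (hR : R.PosDef) (hQf : Qf.PosSemidef) {θ : ℝ}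
    (hθ : 0 < θ) (T : ℕ) (w w' : ℕ → Fin n → ℝ) (u u' : ℕ → Fin m → ℝ) :
    totalCost A B Q R Qf T (w + w') (u + u')
      ≤ (1 + θ) * totalCost A B Q R Qf T w u + (1 + θ⁻¹) * totalCost A B Q R Qf T w' u' := by
  simp only [totalCost, runningCost, mul_add, Finset.mul_sum]
  have h := hQf.form_add_le hθ (state A B w u T) (state A B w' u' T)
  have h2 := Finset.sum_le_sum fun t (_ : t ∈ Finset.range T) =>
    add_le_add (hQ.form_add_le hθ (state A B w u t) (state A B w' u' t))
      (hR.posSemidef.form_add_le hθ (u t) (u' t))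
  simp only [Finset.sum_add_distrib] at h2 ⊢
  simp only [state_add, Pi.add_apply]
  linarith

lemma runningCost_nonneg (hQ : Q.PosSemidef) (hR : R.PosDef) (T : ℕ)
    (w : ℕ → Fin n → ℝ) (u : ℕ → Fin m → ℝ) : 0 ≤ runningCost A B Q R T w u :=
  Finset.sum_nonneg fun _ _ => add_nonneg (hQ.form_nonneg _) (hR.posSemidef.form_nonneg _)

lemma runningCost_mono (hQ : Q.PosSemidef) (hR : R.PosDef) {s T : ℕ} (h : s ≤ T)
    (w : ℕ → Fin n → ℝ) (u : ℕ → Fin m → ℝ) :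
    runningCost A B Q R s w u ≤ runningCost A B Q R T w u :=
  Finset.sum_le_sum_of_subset_of_nonneg (Finset.range_mono h)
    fun _ _ _ => add_nonneg (hQ.form_nonneg _) (hR.posSemidef.form_nonneg _)

lemma totalCost_zero (T : ℕ) (w : ℕ → Fin n → ℝ) (u : ℕ → Fin m → ℝ) :
    totalCost A B Q R 0 T w u = runningCost A B Q R T w u := by
  simp [totalCost]

lemma optValue_nonneg (hQ : Q.PosSemidef) (hR : R.PosDef) (hQf : Qf.PosSemidef) (T : ℕ)
    (w : ℕ → Fin n → ℝ) : 0 ≤ optValue A B Q R Qf T w := by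
  rw [← totalCost_optControl A B Q R Qf hQ hR hQf]
  exact add_nonneg (runningCost_nonneg A B Q R hQ hR _ _ _) (hQf.form_nonneg _)

lemma optValue_zero_le_runningCost (hQ : Q.PosSemidef) (hR : R.PosDef) (T : ℕ)
    (w : ℕ → Fin n → ℝ) (u : ℕ → Fin m → ℝ) :
    optValue A B Q R 0 T w ≤ runningCost A B Q R T w u := by
  rw [← totalCost_zero]
  exact optValue_le_totalCost A B Q R 0 hQ hR .zero T w u

lemma optValue_mono (hQ : Q.PosSemidef) (hR : R.PosDef) {Qf Qf' : Matrix (Fin n) (Fin n) ℝ}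
    (hQf : Qf.PosSemidef) (hQf' : Qf'.PosSemidef) (h : ∀ x, x ⬝ᵥ Qf *ᵥ x ≤ x ⬝ᵥ Qf' *ᵥ x) (T : ℕ)
    (w : ℕ → Fin n → ℝ) : optValue A B Q R Qf T w ≤ optValue A B Q R Qf' T w := by
  rw [← totalCost_optControl A B Q R Qf' hQ hR hQf']
  refine (optValue_le_totalCost A B Q R Qf hQ hR hQf T w (optControl A B Q R Qf' T w)).trans ?_
  rw [totalCost, totalCost]
  exact add_le_add_right (h _) _

end

end LQR

namespace LQR

noncomputable section

/-! ### Stable matrices and Lyapunov forms -/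

lemma exists_form_le {n : ℕ} (Y : Matrix (Fin n) (Fin n) ℝ) :
    ∃ c : ℝ, 0 < c ∧ ∀ x : Fin n → ℝ, x ⬝ᵥ Y *ᵥ x ≤ c * (x ⬝ᵥ x) := by
  refine ⟨∑ i, ∑ j, |Y i j| + 1, by positivity, fun x => ?_⟩
  have hx : ∀ i, x i ^ 2 ≤ x ⬝ᵥ x := fun i => by
    rw [dotProduct, sq]
    exact Finset.single_le_sum (f := fun i => x i * x i) (fun j _ => mul_self_nonneg (x j))
      (Finset.mem_univ i)
  have h0 : 0 ≤ x ⬝ᵥ x := Finset.sum_nonneg fun i _ => mul_self_nonneg (x i)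
  have h : x ⬝ᵥ Y *ᵥ x ≤ (∑ i, ∑ j, |Y i j|) * (x ⬝ᵥ x) := by
    rw [Finset.sum_mul, dotProduct]
    refine Finset.sum_le_sum fun i _ => ?_
    rw [mulVec, dotProduct, Finset.mul_sum, Finset.sum_mul]
    refine Finset.sum_le_sum fun j _ => ?_
    have h1 : |x i * x j| ≤ x ⬝ᵥ x := by
      rw [abs_le]
      constructor <;> nlinarith [hx i, hx j, sq_nonneg (x i - x j), sq_nonneg (x i + x j)]
    calc x i * (Y i j * x j) ≤ |Y i j * (x i * x j)| := by
          rw [show x i * (Y i j * x j) = Y i j * (x i * x j) by ring]; exact le_abs_self _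
      _ ≤ _ := by rw [abs_mul]; gcongr
  linarith

lemma _root_.Matrix.PosDef.exists_le_form {m : ℕ} {R : Matrix (Fin m) (Fin m) ℝ}
    (hR : R.PosDef) : ∃ c : ℝ, 0 < c ∧ ∀ u : Fin m → ℝ, u ⬝ᵥ u ≤ c * (u ⬝ᵥ R *ᵥ u) := by
  obtain ⟨c, hc, h⟩ := exists_form_le R⁻¹
  refine ⟨c, hc, fun u => ?_⟩
  -- Minimizing over this shift would give a sharp bound; the choice -c⁻¹u already yields c⁻¹|u|² ≤
  -- uᵀRu from the upper bound c on R⁻¹.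
  have h1 := complete_square hR u (-(c⁻¹ • u))
  have h2 := hR.posSemidef.form_nonneg (u + R⁻¹ *ᵥ (-(c⁻¹ • u)))
  have h3 := h u
  simp only [mulVec_neg, mulVec_smul, dotProduct_neg, neg_dotProduct, smul_dotProduct,
    dotProduct_smul, smul_eq_mul] at h1 h2
  have h4 : c⁻¹ * (c⁻¹ * u ⬝ᵥ R⁻¹ *ᵥ u) ≤ c⁻¹ * (c⁻¹ * (c * (u ⬝ᵥ u))) := by gcongr
  rw [← mul_assoc c⁻¹ c, inv_mul_cancel₀ hc.ne', one_mul] at h4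
  have h5 : c⁻¹ * (u ⬝ᵥ u) ≤ u ⬝ᵥ R *ᵥ u := by linarith
  rwa [inv_mul_le_iff₀ hc] at h5

section Gelfand

attribute [local instance] Matrix.linftyOpNormedRing Matrix.linftyOpNormedAlgebra

/-- Gelfand's formula: a radius r < 1 strictly above the spectral radius eventually dominates the
k-th root of the norm of the k-th power. -/
lemma exists_norm_pow_lt {n : ℕ} {F : Matrix (Fin n) (Fin n) ℂ} (hF : spectralRadius ℂ F < 1)
    {ε : ℝ} (hε : 0 < ε) : ∃ k : ℕ, ‖F ^ k‖ < ε := by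
  obtain ⟨r, hr1, hr2⟩ := exists_between hF
  have hlim := spectrum.pow_nnnorm_pow_one_div_tendsto_nhds_spectralRadius F
  lift r to NNReal using (hr2.trans ENNReal.one_lt_top).ne
  have hr : (r : ℝ) < 1 := by exact_mod_cast hr2
  obtain ⟨K, hK⟩ := exists_pow_lt_of_lt_one hε hr
  obtain ⟨k, hk1, hk2⟩ := ((hlim.eventually (gt_mem_nhds hr1)).and
    (eventually_ge_atTop (K + 1))).exists
  refine ⟨k, lt_of_le_of_lt ?_ hK⟩
  have hk0 : (0 : ℝ) < k := by exact_mod_cast (by omega : 0 < k)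
  have h1 : (‖F ^ k‖₊ : ENNReal) < (r : ENNReal) ^ (k : ℝ) := by
    rw [one_div] at hk1
    exact (ENNReal.rpow_inv_lt_iff hk0).1 hk1
  rw [ENNReal.rpow_natCast, ← ENNReal.coe_pow, ENNReal.coe_lt_coe] at h1
  have h2 : ‖F ^ k‖ ≤ (r : ℝ) ^ k := by exact_mod_cast h1.le
  exact h2.trans (pow_le_pow_of_le_one r.2 hr.le (by omega))

lemma exists_pow_contract {n : ℕ} {F : Matrix (Fin n) (Fin n) ℝ}
    (hF : spectralRadius ℂ (F.map (algebraMap ℝ ℂ)) < 1) :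
    ∃ k : ℕ, ∀ x : Fin n → ℝ, 2 * ((F ^ k *ᵥ x) ⬝ᵥ (F ^ k *ᵥ x)) ≤ x ⬝ᵥ x := by
  -- Passing from the sup norm to the Euclidean norm costs a factor n on squares, and b ≤ 1/(2n+1)
  -- ensures 2nb² ≤ 1.
  obtain ⟨k, hk⟩ := exists_norm_pow_lt hF (show (0 : ℝ) < 1 / (2 * n + 1) by positivity)
  refine ⟨k, fun x => ?_⟩
  set y := F ^ k *ᵥ x with hy
  have hn : ((algebraMap ℝ ℂ) ∘ y) = (F.map (algebraMap ℝ ℂ)) ^ k *ᵥ ((algebraMap ℝ ℂ) ∘ x) := by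
    have e : (F.map (algebraMap ℝ ℂ)) ^ k = (F ^ k).map (algebraMap ℝ ℂ) := by
      have := map_pow (RingHom.mapMatrix (m := Fin n) (algebraMap ℝ ℂ)) F k
      simpa using this.symm
    ext i
    rw [e, hy]
    exact RingHom.map_mulVec _ _ _ _
  have hb := Matrix.linfty_opNorm_mulVec ((F.map (algebraMap ℝ ℂ)) ^ k) ((algebraMap ℝ ℂ) ∘ x)
  rw [← hn] at hb
  have hxs : ‖(algebraMap ℝ ℂ) ∘ x‖ ^ 2 ≤ x ⬝ᵥ x := by
    have h0 : 0 ≤ x ⬝ᵥ x := Finset.sum_nonneg fun i _ => mul_self_nonneg (x i)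
    have h1 : ‖(algebraMap ℝ ℂ) ∘ x‖ ≤ Real.sqrt (x ⬝ᵥ x) := by
      rw [pi_norm_le_iff_of_nonneg (Real.sqrt_nonneg _)]
      intro i
      simp only [Function.comp_apply, norm_algebraMap', Real.norm_eq_abs]
      refine Real.abs_le_sqrt ?_
      rw [dotProduct, sq]
      exact Finset.single_le_sum (f := fun i => x i * x i) (fun j _ => mul_self_nonneg (x j))
        (Finset.mem_univ i)
    calc _ ≤ Real.sqrt (x ⬝ᵥ x) ^ 2 := by gcongr
      _ = _ := Real.sq_sqrt h0
  have hys : y ⬝ᵥ y ≤ n * ‖(algebraMap ℝ ℂ) ∘ y‖ ^ 2 := by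
    calc y ⬝ᵥ y ≤ ∑ _i : Fin n, ‖(algebraMap ℝ ℂ) ∘ y‖ ^ 2 := by
          refine Finset.sum_le_sum fun i _ => ?_
          have := norm_le_pi_norm ((algebraMap ℝ ℂ) ∘ y) i
          simp only [Function.comp_apply, norm_algebraMap', Real.norm_eq_abs] at this
          rw [← sq, ← sq_abs]
          gcongr
      _ = _ := by simp
  have hN0 : 0 ≤ ‖(F.map (algebraMap ℝ ℂ)) ^ k‖ := norm_nonneg _
  set b := ‖(F.map (algebraMap ℝ ℂ)) ^ k‖
  have hb1 : b * (2 * n + 1) ≤ 1 := by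
    rw [lt_div_iff₀ (by positivity)] at hk; exact hk.le
  have hn0 : (0 : ℝ) ≤ n := by positivity
  have hb2 : 2 * (n * b ^ 2) ≤ 1 := by nlinarith [mul_nonneg hn0 hN0]
  have hsq : ‖(algebraMap ℝ ℂ) ∘ y‖ ^ 2 ≤ b ^ 2 * ‖(algebraMap ℝ ℂ) ∘ x‖ ^ 2 := by
    rw [← mul_pow]; gcongr
  calc 2 * (y ⬝ᵥ y) ≤ 2 * (n * (b ^ 2 * ‖(algebraMap ℝ ℂ) ∘ x‖ ^ 2)) := by
        have := mul_le_mul_of_nonneg_left hsq hn0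
        linarith
    _ = 2 * (n * b ^ 2) * ‖(algebraMap ℝ ℂ) ∘ x‖ ^ 2 := by ring
    _ ≤ 1 * ‖(algebraMap ℝ ℂ) ∘ x‖ ^ 2 := by gcongr
    _ ≤ _ := by linarith

end Gelfand

/-- With Y = 2c ∑_{i<k} (Fⁱ)ᵀFⁱ the difference of the two forms telescopes to 2c(|x|² - |F^k x|²).
This is at least c|x|² once F^k halves squared norms. -/
lemma exists_lyapunov {n : ℕ} {F : Matrix (Fin n) (Fin n) ℝ}
    (hF : spectralRadius ℂ (F.map (algebraMap ℝ ℂ)) < 1) {c : ℝ} (hc : 0 < c) :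
    ∃ Y : Matrix (Fin n) (Fin n) ℝ, Y.PosSemidef ∧
      ∀ x, c * (x ⬝ᵥ x) + (F *ᵥ x) ⬝ᵥ Y *ᵥ (F *ᵥ x) ≤ x ⬝ᵥ Y *ᵥ x := by
  obtain ⟨k, hk⟩ := exists_pow_contract hF
  have hform : ∀ x, x ⬝ᵥ ((2 * c) • ∑ i ∈ Finset.range k, (F ^ i)ᵀ * F ^ i) *ᵥ x
      = 2 * c * ∑ i ∈ Finset.range k, (F ^ i *ᵥ x) ⬝ᵥ (F ^ i *ᵥ x) := by
    intro x
    rw [smul_mulVec, dotProduct_smul, smul_eq_mul, sum_mulVec, dotProduct_sum]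
    congr 1
    refine Finset.sum_congr rfl fun i _ => ?_
    rw [← mulVec_mulVec, dotProduct_comm, mulVec_transpose_dotProduct]
  refine ⟨(2 * c) • ∑ i ∈ Finset.range k, (F ^ i)ᵀ * F ^ i, ?_, fun x => ?_⟩
  · refine posSemidef_of_form ?_ fun x => ?_
    · simp [transpose_sum]
    · rw [hform]
      exact mul_nonneg (by positivity) (Finset.sum_nonneg fun i _ =>
        Finset.sum_nonneg fun j _ => mul_self_nonneg _)
  · rw [hform, hform]
    have e : ∑ i ∈ Finset.range k, (F ^ i *ᵥ (F *ᵥ x)) ⬝ᵥ (F ^ i *ᵥ (F *ᵥ x))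
        = ∑ i ∈ Finset.range k, (F ^ i *ᵥ x) ⬝ᵥ (F ^ i *ᵥ x)
          + (F ^ k *ᵥ x) ⬝ᵥ (F ^ k *ᵥ x) - x ⬝ᵥ x := by
      have h1 := Finset.sum_range_succ (fun i => (F ^ i *ᵥ x) ⬝ᵥ (F ^ i *ᵥ x)) k
      have h2 := Finset.sum_range_succ' (fun i => (F ^ i *ᵥ x) ⬝ᵥ (F ^ i *ᵥ x)) k
      simp only [pow_zero, one_mulVec] at h2
      simp only [mulVec_mulVec, ← pow_succ]
      linarith
    rw [e]
    nlinarith [hk x]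

/-! ### Switching to a stabilizing feedback -/

variable {n m : ℕ} (A : Matrix (Fin n) (Fin n) ℝ) (B : Matrix (Fin n) (Fin m) ℝ)
    (Q : Matrix (Fin n) (Fin n) ℝ) (R : Matrix (Fin m) (Fin m) ℝ)
    (Qf : Matrix (Fin n) (Fin n) ℝ)

/-- The trajectory which follows `u` before time `s` and the feedback `-K x` from then on. -/
def switchState (K : Matrix (Fin m) (Fin n) ℝ) (s : ℕ) (w : ℕ → Fin n → ℝ) (u : ℕ → Fin m → ℝ) :
    ℕ → Fin n → ℝ
  | 0 => 0
  | t + 1 => A *ᵥ switchState K s w u t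
      + B *ᵥ (if t < s then u t else -(K *ᵥ switchState K s w u t)) + w t

lemma exists_switchControl (K : Matrix (Fin m) (Fin n) ℝ) (s : ℕ) (w : ℕ → Fin n → ℝ)
    (u : ℕ → Fin m → ℝ) :
    ∃ u' : ℕ → Fin m → ℝ, (∀ t < s, u' t = u t) ∧ ∀ t, s ≤ t → u' t = -(K *ᵥ state A B w u' t) := by
  refine ⟨fun t => if t < s then u t else -(K *ᵥ switchState A B K s w u t),
    fun t ht => if_pos ht, fun t ht => ?_⟩
  have h : ∀ t, state A B w (fun t => if t < s then u t else -(K *ᵥ switchState A B K s w u t)) t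
      = switchState A B K s w u t := by
    intro t
    induction t with
    | zero => rfl
    | succ t ih => rw [state, ih, switchState]
  rw [h]
  exact if_neg (by omega)

lemma state_congr {w : ℕ → Fin n → ℝ} {u u' : ℕ → Fin m → ℝ} {t : ℕ}
    (h : ∀ r < t, u r = u' r) : state A B w u t = state A B w u' t := by
  induction t with
  | zero => rfl
  | succ t ih => rw [state, state, ih fun r hr => h r (by omega), h t (by omega)]

lemma state_congr_noise {w w' : ℕ → Fin n → ℝ} {u : ℕ → Fin m → ℝ} {t : ℕ}
    (h : ∀ r < t, w r = w' r) : state A B w u t = state A B w' u t := by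
  induction t with
  | zero => rfl
  | succ t ih => rw [state, state, ih fun r hr => h r (by omega), h t (by omega)]

/-- A terminal weight `Y` above any two given ones, for which stabilizing the system from a time
`s` on costs no more than the weight of the state at time `s`, up to the energy of the noise. -/
lemma exists_stabilizing_weight (hAB : Stabilizable A B)
    (P : Matrix (Fin n) (Fin n) ℝ) :
    ∃ Y : Matrix (Fin n) (Fin n) ℝ, Y.PosSemidef ∧ (∀ x, x ⬝ᵥ Qf *ᵥ x ≤ x ⬝ᵥ Y *ᵥ x) ∧
      (∀ x, x ⬝ᵥ P *ᵥ x ≤ x ⬝ᵥ Y *ᵥ x) ∧ ∃ C : ℝ, 0 < C ∧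
      ∀ (w : ℕ → Fin n → ℝ) (u : ℕ → Fin m → ℝ) (s T : ℕ), s ≤ T →
        ∃ u', totalCost A B Q R Y T w u' ≤ runningCost A B Q R s w u
          + state A B w u s ⬝ᵥ Y *ᵥ state A B w u s + C * ∑ t ∈ Finset.Ico s T, w t ⬝ᵥ w t := by
  obtain ⟨K, hK⟩ := hAB
  obtain ⟨c₁, hc₁, h₁⟩ := exists_form_le Qf
  obtain ⟨c₂, hc₂, h₂⟩ := exists_form_le P
  obtain ⟨c₃, hc₃, h₃⟩ := exists_form_le Q
  obtain ⟨c₄, hc₄, h₄⟩ := exists_form_le (Kᵀ * R * K)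
  -- The Lyapunov decrement is budgeted: c₁ and c₂ make Y dominate Qf and P, c₃ and c₄ pay for the
  -- state and control costs under the feedback, and the last 1 pays for Young's inequality.
  obtain ⟨Y, hY, hlyap⟩ := exists_lyapunov hK (show 0 < c₁ + c₂ + c₃ + c₄ + 1 by positivity)
  obtain ⟨c₅, hc₅, h₅⟩ := exists_form_le ((A - B * K)ᵀ * Y * (A - B * K))
  obtain ⟨c₆, hc₆, h₆⟩ := exists_form_le Y
  have hconj : ∀ {a b : ℕ} (N : Matrix (Fin a) (Fin b) ℝ) (Z : Matrix (Fin a) (Fin a) ℝ)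
      (x : Fin b → ℝ), x ⬝ᵥ (Nᵀ * Z * N) *ᵥ x = (N *ᵥ x) ⬝ᵥ Z *ᵥ (N *ᵥ x) := by
    intro a b N Z x
    rw [← mulVec_mulVec, ← mulVec_mulVec, ← mulVec_transpose_dotProduct Nᵀ, transpose_transpose]
  simp only [hconj] at h₄ h₅
  have hsq : ∀ x : Fin n → ℝ, 0 ≤ x ⬝ᵥ x := fun x =>
    Finset.sum_nonneg fun i _ => mul_self_nonneg (x i)
  have hlow : ∀ x, (c₁ + c₂ + c₃ + c₄ + 1) * (x ⬝ᵥ x) ≤ x ⬝ᵥ Y *ᵥ x := fun x => by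
    linarith [hlyap x, hY.form_nonneg ((A - B * K) *ᵥ x)]
  -- With θ = c₅⁻¹ the extra θ-multiple of the form at (A - BK)x is at most |x|², exactly the
  -- reserved unit.
  have hθ : 0 < c₅⁻¹ := by positivity
  have hstep : ∀ x e : Fin n → ℝ, x ⬝ᵥ Q *ᵥ x + (K *ᵥ x) ⬝ᵥ R *ᵥ (K *ᵥ x)
      + ((A - B * K) *ᵥ x + e) ⬝ᵥ Y *ᵥ ((A - B * K) *ᵥ x + e)
      ≤ x ⬝ᵥ Y *ᵥ x + (1 + c₅) * c₆ * (e ⬝ᵥ e) := by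
    intro x e
    have hy := hY.form_add_le hθ ((A - B * K) *ᵥ x) e
    rw [inv_inv] at hy
    have h5 : c₅⁻¹ * (((A - B * K) *ᵥ x) ⬝ᵥ Y *ᵥ ((A - B * K) *ᵥ x)) ≤ x ⬝ᵥ x := by
      rw [inv_mul_le_iff₀ hc₅]; exact h₅ x
    have h6 : (1 + c₅) * (e ⬝ᵥ Y *ᵥ e) ≤ (1 + c₅) * (c₆ * (e ⬝ᵥ e)) :=
      mul_le_mul_of_nonneg_left (h₆ e) (by positivity)
    have hl := hlyap x
    have := h₃ x
    have := h₄ x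
    have := mul_nonneg (add_pos hc₁ hc₂).le (hsq x)
    nlinarith
  refine ⟨Y, hY, fun x => ?_, fun x => ?_, (1 + c₅) * c₆, by positivity, ?_⟩
  · have := mul_nonneg (show 0 ≤ c₂ + c₃ + c₄ + 1 by positivity) (hsq x)
    nlinarith [hlow x, h₁ x]
  · have := mul_nonneg (show 0 ≤ c₁ + c₃ + c₄ + 1 by positivity) (hsq x)
    nlinarith [hlow x, h₂ x]
  intro w u s T hsT
  obtain ⟨u', hu1, hu2⟩ := exists_switchControl A B K s w u
  refine ⟨u', ?_⟩
  induction T, hsT using Nat.le_induction with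
  | base =>
    rw [Finset.Ico_self, Finset.sum_empty, mul_zero, add_zero, totalCost]
    refine le_of_eq (congr_arg₂ _ (Finset.sum_congr rfl fun t ht => ?_) ?_)
    · have ht' := Finset.mem_range.1 ht
      rw [state_congr A B fun r (hr : r < t) => hu1 r (by omega), hu1 t ht']
    · rw [state_congr A B hu1]
  | succ T hsT ih =>
    have h := hstep (state A B w u' T) (w T)
    have e : state A B w u' (T + 1) = (A - B * K) *ᵥ state A B w u' T + w T := by
      rw [state, hu2 T hsT, sub_mulVec, ← mulVec_mulVec, mulVec_neg, sub_eq_add_neg]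
    have e2 : u' T ⬝ᵥ R *ᵥ u' T = (K *ᵥ state A B w u' T) ⬝ᵥ R *ᵥ (K *ᵥ state A B w u' T) := by
      rw [hu2 T hsT, mulVec_neg, dotProduct_neg, neg_dotProduct, neg_neg]
    rw [Finset.sum_Ico_succ_top hsT, mul_add]
    rw [totalCost, runningCost] at ih ⊢
    rw [Finset.sum_range_succ, e, e2]
    linarith

/-! ### Filtered trajectories -/

/-- The sequence `f` filtered by the coefficients of the polynomial `p`. -/
def filt {d : ℕ} (p : Polynomial ℝ) (f : ℕ → Fin d → ℝ) (t : ℕ) : Fin d → ℝ :=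
  ∑ j ∈ Finset.range (t + 1), p.coeff j • f (t - j)

lemma filt_apply {d : ℕ} (p : Polynomial ℝ) (f : ℕ → Fin d → ℝ) (t : ℕ) (i : Fin d) :
    filt p f t i
      = PowerSeries.coeff t ((p : PowerSeries ℝ) * PowerSeries.mk fun t => f t i) := by
  rw [PowerSeries.coeff_mul, Finset.Nat.sum_antidiagonal_eq_sum_range_succ_mk, filt,
    Finset.sum_apply]
  simp

lemma mulVec_filt {d e : ℕ} (G : Matrix (Fin e) (Fin d) ℝ) (p : Polynomial ℝ)
    (f : ℕ → Fin d → ℝ) (t : ℕ) : G *ᵥ filt p f t = filt p (fun t => G *ᵥ f t) t := by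
  simp only [filt, mulVec_sum, mulVec_smul]

/-- Time invariance and linearity would leave a transient from the initial state; it vanishes
because x₀ = 0. -/
lemma state_filt (p : Polynomial ℝ) (w : ℕ → Fin n → ℝ) (u : ℕ → Fin m → ℝ) (t : ℕ) :
    state A B (filt p w) (filt p u) t = filt p (state A B w u) t := by
  induction t with
  | zero => simp [state, filt]
  | succ t ih =>
    rw [state, ih, mulVec_filt, mulVec_filt]
    conv_rhs => rw [filt, Finset.sum_range_succ]
    simp only [filt, Nat.sub_self]
    rw [show state A B w u 0 = 0 from rfl, smul_zero, add_zero, ← Finset.sum_add_distrib,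
      ← Finset.sum_add_distrib]
    refine Finset.sum_congr rfl fun j hj => ?_
    rw [show t + 1 - j = (t - j) + 1 by have := Finset.mem_range.1 hj; omega, state, smul_add,
      smul_add]

/-- A filter which contracts scalar sequences contracts every positive semidefinite form. -/
lemma sum_form_filt_le {d : ℕ} {p : Polynomial ℝ}
    (hp : ∀ (f : PowerSeries ℝ) (s : ℕ),
      ∑ t ∈ Finset.range s, PowerSeries.coeff t ((p : PowerSeries ℝ) * f) ^ 2
        ≤ ∑ t ∈ Finset.range s, PowerSeries.coeff t f ^ 2)
    {Z : Matrix (Fin d) (Fin d) ℝ} (hZ : Z.PosSemidef) (f : ℕ → Fin d → ℝ) (s : ℕ) :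
    ∑ t ∈ Finset.range s, filt p f t ⬝ᵥ Z *ᵥ filt p f t
      ≤ ∑ t ∈ Finset.range s, f t ⬝ᵥ Z *ᵥ f t := by
  -- Writing Z = GᵀG reduces the form to scalar sequences, the components of G f, with which the
  -- filter commutes.
  obtain ⟨G, rfl⟩ : ∃ G : Matrix (Fin d) (Fin d) ℝ, Z = Gᵀ * G := by
    open scoped MatrixOrder in
    obtain ⟨G, hG⟩ := CStarAlgebra.nonneg_iff_eq_star_mul_self.mp hZ.nonneg
    exact ⟨G, by rw [hG, star_eq_conjTranspose, conjTranspose_eq_transpose_of_trivial]⟩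
  have e : ∀ x : Fin d → ℝ, x ⬝ᵥ (Gᵀ * G) *ᵥ x = ∑ i, (G *ᵥ x) i ^ 2 := by
    intro x
    rw [← mulVec_mulVec, ← mulVec_transpose_dotProduct Gᵀ, transpose_transpose, dotProduct]
    exact Finset.sum_congr rfl fun i _ => (sq _).symm
  simp only [e]
  rw [Finset.sum_comm, Finset.sum_comm (s := Finset.range s)]
  refine Finset.sum_le_sum fun i _ => ?_
  simp only [mulVec_filt, filt_apply]
  simpa using hp (PowerSeries.mk fun t => (G *ᵥ f t) i) s

/-- Filtered by a multiple of the reverse characteristic polynomial, the state is a finite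
impulse response to the input. -/
lemma exists_sum_filt_state_le (p : Polynomial ℝ) :
    ∃ C : ℝ, 0 < C ∧ ∀ (w : ℕ → Fin n → ℝ) (u : ℕ → Fin m → ℝ) (s : ℕ),
      ∑ t ∈ Finset.range s, filt (A.charpolyRev * p) (state A B w u) t ⬝ᵥ
          filt (A.charpolyRev * p) (state A B w u) t
        ≤ C * ∑ t ∈ Finset.range s, (u t ⬝ᵥ u t + w t ⬝ᵥ w t) := by
  -- The generating function of the state solves (1 - XA) x = X g with g = Bu + w, so by Cramer's
  -- rule det(1 - XA) x = adj(1 - XA) X g, a polynomial filter of the input.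
  set N : Matrix (Fin n) (Fin n) (Polynomial ℝ) :=
    1 - (Polynomial.X : Polynomial ℝ) • A.map Polynomial.C with hN
  have hdet : A.charpolyRev = N.det := rfl
  -- These are the scalar filters taking the j-th input component to the i-th filtered state
  -- component; the factor X is the one-step delay of the dynamics.
  choose c hc hbound using fun i j => exists_filter_bound (p * N.adjugate i j * Polynomial.X)
  obtain ⟨b, hb, hB⟩ := exists_form_le (Bᵀ * B)
  refine ⟨(∑ i, ∑ j, n * c i j) * (2 * b + 2) + 1, ?_, fun w u s => ?_⟩
  · have : 0 ≤ ∑ i, ∑ j, n * c i j := Finset.sum_nonneg fun i _ => Finset.sum_nonneg fun j _ =>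
      mul_nonneg (by positivity) (hc i j).le
    positivity
  set x := state A B w u with hx
  set g : ℕ → Fin n → ℝ := fun t => B *ᵥ u t + w t with hg
  let X' : Fin n → PowerSeries ℝ := fun i => PowerSeries.mk fun t => x t i
  let G' : Fin n → PowerSeries ℝ := fun i => PowerSeries.mk fun t => g t i
  let φ : Polynomial ℝ →+* PowerSeries ℝ := Polynomial.coeToPowerSeries.ringHom
  have hrel : φ.mapMatrix N *ᵥ X' = fun i => PowerSeries.X * G' i := by
    have hN' : φ.mapMatrix N = 1 - (PowerSeries.X : PowerSeries ℝ) • A.map (PowerSeries.C) := by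
      rw [hN, map_sub, map_one]
      congr 1
      ext i j : 1
      simp only [RingHom.mapMatrix_apply, Matrix.map_apply, Matrix.smul_apply, smul_eq_mul, map_mul]
      simp [φ]
    rw [hN', sub_mulVec, one_mulVec, smul_mulVec]
    funext i
    ext t
    simp only [Pi.sub_apply, Pi.smul_apply, smul_eq_mul, map_sub]
    cases t with
    | zero => simp [X', hx, state]
    | succ t =>
      rw [PowerSeries.coeff_succ_X_mul, PowerSeries.coeff_succ_X_mul, mulVec, dotProduct, map_sum]
      simp only [Matrix.map_apply, PowerSeries.coeff_C_mul, X', G', PowerSeries.coeff_mk, hg]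
      rw [hx, state]
      simp only [Pi.add_apply, mulVec, dotProduct]
      ring
  have hsol : ∀ i, ((A.charpolyRev : Polynomial ℝ) : PowerSeries ℝ) * X' i
      = ∑ j, ((N.adjugate i j : Polynomial ℝ) : PowerSeries ℝ) * (PowerSeries.X * G' j) := by
    intro i
    have h1 : φ.mapMatrix N.adjugate *ᵥ (φ.mapMatrix N *ᵥ X') = φ N.det • X' := by
      rw [mulVec_mulVec, ← map_mul, adjugate_mul]
      funext i
      rw [RingHom.mapMatrix_apply, mulVec, dotProduct]
      simp [Matrix.one_apply, Finset.sum_ite_eq, smul_eq_mul, mul_ite, apply_ite φ]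
    rw [hrel] at h1
    have h2 := congr_fun h1 i
    simp only [mulVec, dotProduct, RingHom.mapMatrix_apply, Matrix.map_apply, Pi.smul_apply,
      smul_eq_mul] at h2
    rw [hdet]
    exact h2.symm
  have hfilt : ∀ i, ∑ t ∈ Finset.range s, filt (A.charpolyRev * p) x t i ^ 2
      ≤ ∑ j, n * c i j * ∑ t ∈ Finset.range s, g t j ^ 2 := by
    intro i
    let y : Fin n → ℕ → ℝ := fun j t => PowerSeries.coeff t
      (((p * N.adjugate i j * Polynomial.X : Polynomial ℝ) : PowerSeries ℝ) * G' j)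
    have e : ∀ t, filt (A.charpolyRev * p) x t i = ∑ j, y j t := by
      intro t
      rw [filt_apply, ← map_sum]
      congr 1
      calc (((A.charpolyRev * p : Polynomial ℝ)) : PowerSeries ℝ) * X' i
          = (p : PowerSeries ℝ) * (((A.charpolyRev : Polynomial ℝ) : PowerSeries ℝ) * X' i) := by
            rw [Polynomial.coe_mul]; ring
        _ = _ := by
            rw [hsol, Finset.mul_sum]
            refine Finset.sum_congr rfl fun j _ => ?_
            rw [Polynomial.coe_mul, Polynomial.coe_mul, Polynomial.coe_X]; ring
    calc ∑ t ∈ Finset.range s, filt (A.charpolyRev * p) x t i ^ 2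
        ≤ ∑ t ∈ Finset.range s, n * ∑ j, y j t ^ 2 := by
          refine Finset.sum_le_sum fun t _ => ?_
          rw [e]
          simpa using sq_sum_le_card_mul_sum_sq (s := (Finset.univ : Finset (Fin n)))
            (f := fun j => y j t)
      _ = n * ∑ j, ∑ t ∈ Finset.range s, y j t ^ 2 := by
          rw [← Finset.mul_sum, Finset.sum_comm]
      _ ≤ n * ∑ j, c i j * ∑ t ∈ Finset.range s, g t j ^ 2 := by
          gcongr with j _
          have h := hbound i j (G' j) s
          simp only [G', PowerSeries.coeff_mk] at h
          exact h
      _ = _ := by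
          rw [Finset.mul_sum]
          exact Finset.sum_congr rfl fun j _ => by ring
  have hgj : ∀ j, ∑ t ∈ Finset.range s, g t j ^ 2
      ≤ (2 * b + 2) * ∑ t ∈ Finset.range s, (u t ⬝ᵥ u t + w t ⬝ᵥ w t) := by
    intro j
    rw [Finset.mul_sum]
    refine Finset.sum_le_sum fun t _ => ?_
    have h1 : g t j ^ 2 ≤ 2 * (B *ᵥ u t) j ^ 2 + 2 * w t j ^ 2 := by
      simp only [hg, Pi.add_apply]
      nlinarith [sq_nonneg ((B *ᵥ u t) j - w t j)]
    have hle : ∀ y : Fin n → ℝ, y j ^ 2 ≤ y ⬝ᵥ y := fun y => by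
      rw [dotProduct, sq]
      exact Finset.single_le_sum (f := fun i => y i * y i) (fun j _ => mul_self_nonneg (y j))
        (Finset.mem_univ j)
    have h2 := hB (u t)
    rw [← mulVec_mulVec, ← mulVec_transpose_dotProduct Bᵀ, transpose_transpose] at h2
    have h3 := hle (B *ᵥ u t)
    have h4 := hle (w t)
    have h5 : 0 ≤ u t ⬝ᵥ u t := Finset.sum_nonneg fun i _ => mul_self_nonneg _
    have h6 : 0 ≤ w t ⬝ᵥ w t := Finset.sum_nonneg fun i _ => mul_self_nonneg _
    nlinarith [mul_nonneg hb.le h6]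
  have hS : 0 ≤ ∑ t ∈ Finset.range s, (u t ⬝ᵥ u t + w t ⬝ᵥ w t) :=
    Finset.sum_nonneg fun t _ => add_nonneg (Finset.sum_nonneg fun i _ => mul_self_nonneg _)
      (Finset.sum_nonneg fun i _ => mul_self_nonneg _)
  calc ∑ t ∈ Finset.range s, filt (A.charpolyRev * p) x t ⬝ᵥ filt (A.charpolyRev * p) x t
      = ∑ i, ∑ t ∈ Finset.range s, filt (A.charpolyRev * p) x t i ^ 2 := by
        rw [Finset.sum_comm]
        exact Finset.sum_congr rfl fun t _ => Finset.sum_congr rfl fun i _ => (sq _).symm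
    _ ≤ ∑ i, ∑ j, n * c i j * ((2 * b + 2) *
          ∑ t ∈ Finset.range s, (u t ⬝ᵥ u t + w t ⬝ᵥ w t)) := by
        refine Finset.sum_le_sum fun i _ => (hfilt i).trans (Finset.sum_le_sum fun j _ => ?_)
        exact mul_le_mul_of_nonneg_left (hgj j) (mul_nonneg (by positivity) (hc i j).le)
    _ = (∑ i, ∑ j, n * c i j) * (2 * b + 2) *
          ∑ t ∈ Finset.range s, (u t ⬝ᵥ u t + w t ⬝ᵥ w t) := by
        simp only [Finset.sum_mul]
        exact Finset.sum_congr rfl fun i _ => Finset.sum_congr rfl fun j _ => by ring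
    _ ≤ _ := by nlinarith

end

end LQR

namespace LQR

noncomputable section

/-! ### Square integrable random vectors and white noise -/

section Vector

variable {Ω : Type*} [MeasurableSpace Ω] {μ : Measure Ω} {d e : ℕ}

/-- All components of the random vector are square integrable. -/
def L2vec (μ : Measure Ω) (X : Ω → Fin d → ℝ) : Prop := ∀ i, MemLp (fun ω => X ω i) 2 μ

lemma L2vec.zero : L2vec μ (fun _ => (0 : Fin d → ℝ)) := fun i => by simp

lemma L2vec.add {X Y : Ω → Fin d → ℝ} (hX : L2vec μ X) (hY : L2vec μ Y) :
    L2vec μ (fun ω => X ω + Y ω) := fun i => (hX i).add (hY i)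

lemma L2vec.sub {X Y : Ω → Fin d → ℝ} (hX : L2vec μ X) (hY : L2vec μ Y) :
    L2vec μ (fun ω => X ω - Y ω) := fun i => (hX i).sub (hY i)

lemma L2vec.neg {X : Ω → Fin d → ℝ} (hX : L2vec μ X) : L2vec μ (fun ω => -X ω) :=
  fun i => (hX i).neg

lemma L2vec.mulVec {X : Ω → Fin d → ℝ} (hX : L2vec μ X) (G : Matrix (Fin e) (Fin d) ℝ) :
    L2vec μ (fun ω => G *ᵥ X ω) := fun i => by
  simp only [Matrix.mulVec, dotProduct]
  exact memLp_finsetSum _ fun j _ => (hX j).const_mul (G i j)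

lemma L2vec.sum {ι : Type*} (s : Finset ι) {X : ι → Ω → Fin d → ℝ} (hX : ∀ j ∈ s, L2vec μ (X j)) :
    L2vec μ (fun ω => ∑ j ∈ s, X j ω) := fun i => by
  simp only [Finset.sum_apply]
  exact memLp_finsetSum _ fun j hj => hX j hj i

lemma L2vec.smul {X : Ω → Fin d → ℝ} (hX : L2vec μ X) (c : ℝ) : L2vec μ (fun ω => c • X ω) :=
  fun i => (hX i).const_mul c

lemma L2vec.integrable_dotProduct {X Y : Ω → Fin d → ℝ} (hX : L2vec μ X) (hY : L2vec μ Y) :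
    Integrable (fun ω => X ω ⬝ᵥ Y ω) μ := by
  simp only [dotProduct]
  exact integrable_finsetSum _ fun i _ => (hX i).integrable_mul (hY i)

lemma L2vec.filt {X : ℕ → Ω → Fin d → ℝ} {t : ℕ} (hX : ∀ s ≤ t, L2vec μ (X s))
    (p : Polynomial ℝ) : L2vec μ (fun ω => filt p (fun s => X s ω) t) :=
  L2vec.sum _ fun j _ => (hX (t - j) (by omega)).smul _

/-- White noise with covariance matrix `W`. -/
structure IsWhite (μ : Measure Ω) (W : Matrix (Fin d) (Fin d) ℝ) (w : ℕ → Ω → Fin d → ℝ) :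
    Prop where
  l2 : ∀ t, L2vec μ (w t)
  cov : ∀ s t i j, ∫ ω, w s ω i * w t ω j ∂μ = if s = t then W i j else 0

lemma IsWhite.shift {W : Matrix (Fin d) (Fin d) ℝ} {w : ℕ → Ω → Fin d → ℝ} (hw : IsWhite μ W w)
    (N : ℕ) : IsWhite μ W (fun t => w (N + t)) :=
  ⟨fun t => hw.l2 _, fun s t i j => by rw [hw.cov]; simp⟩

lemma IsWhite.transpose_eq {W : Matrix (Fin d) (Fin d) ℝ} {w : ℕ → Ω → Fin d → ℝ}
    (hw : IsWhite μ W w) : Wᵀ = W := by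
  ext i j
  have h1 := hw.cov 0 0 i j
  have h2 := hw.cov 0 0 j i
  rw [if_pos rfl] at h1 h2
  rw [transpose_apply, ← h1, ← h2]
  simp only [mul_comm]

/-- Second moments at different times vanish; at equal times the bilinear form is contracted with W,
and the symmetry of W puts the trace in this order. -/
lemma IsWhite.integral_dotProduct_single {W : Matrix (Fin d) (Fin d) ℝ} {w : ℕ → Ω → Fin d → ℝ}
    (hw : IsWhite μ W w) (G H : Matrix (Fin e) (Fin d) ℝ) (s t : ℕ) :
    ∫ ω, (G *ᵥ w s ω) ⬝ᵥ (H *ᵥ w t ω) ∂μ = if s = t then (W * (Gᵀ * H)).trace else 0 := by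
  have hint : ∀ i j, Integrable (fun ω => w s ω i * w t ω j) μ := fun i j =>
    (hw.l2 s i).integrable_mul (hw.l2 t j)
  have hexp : ∀ ω, (G *ᵥ w s ω) ⬝ᵥ (H *ᵥ w t ω)
      = ∑ a, ∑ i, ∑ j, G a i * H a j * (w s ω i * w t ω j) := by
    intro ω
    simp only [dotProduct, Matrix.mulVec, Finset.sum_mul_sum]
    refine Finset.sum_congr rfl fun a _ => Finset.sum_congr rfl fun i _ =>
      Finset.sum_congr rfl fun j _ => by ring
  simp only [hexp]
  rw [integral_finsetSum _ fun a _ => integrable_finsetSum _ fun i _ => integrable_finsetSum _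
    fun j _ => (hint i j).const_mul _]
  have e2 : ∀ a, ∫ ω, ∑ i, ∑ j, G a i * H a j * (w s ω i * w t ω j) ∂μ
      = ∑ i, ∑ j, G a i * H a j * (if s = t then W i j else 0) := by
    intro a
    rw [integral_finsetSum _ fun i _ => integrable_finsetSum _ fun j _ => (hint i j).const_mul _]
    refine Finset.sum_congr rfl fun i _ => ?_
    rw [integral_finsetSum _ fun j _ => (hint i j).const_mul _]
    refine Finset.sum_congr rfl fun j _ => ?_
    rw [integral_const_mul, hw.cov]
  simp only [e2]
  split_ifs with h
  · simp only [Matrix.trace, diag_apply, Matrix.mul_apply, transpose_apply, Finset.mul_sum]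
    rw [Finset.sum_comm]
    refine (Finset.sum_congr rfl fun i _ => Finset.sum_comm).trans ?_
    rw [Finset.sum_comm]
    refine Finset.sum_congr rfl fun j _ => Finset.sum_congr rfl fun i _ =>
      Finset.sum_congr rfl fun a _ => ?_
    rw [show W j i = W i j from congr_fun (congr_fun hw.transpose_eq i) j]
    ring
  · simp

lemma IsWhite.integral_dotProduct {W : Matrix (Fin d) (Fin d) ℝ} {w : ℕ → Ω → Fin d → ℝ}
    (hw : IsWhite μ W w) (G H : ℕ → Matrix (Fin e) (Fin d) ℝ) (k : ℕ) :
    ∫ ω, (∑ s ∈ Finset.range k, G s *ᵥ w s ω) ⬝ᵥ (∑ s ∈ Finset.range k, H s *ᵥ w s ω) ∂μ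
      = ∑ s ∈ Finset.range k, (W * ((G s)ᵀ * H s)).trace := by
  simp only [sum_dotProduct]
  simp only [dotProduct_sum]
  have hint : ∀ s t, Integrable (fun ω => (G s *ᵥ w s ω) ⬝ᵥ (H t *ᵥ w t ω)) μ := fun s t =>
    ((hw.l2 s).mulVec _).integrable_dotProduct ((hw.l2 t).mulVec _)
  rw [integral_finsetSum _ fun s _ => integrable_finsetSum _ fun t _ => hint s t]
  refine Finset.sum_congr rfl fun s hs => ?_
  rw [integral_finsetSum _ fun t _ => hint s t]
  simp only [hw.integral_dotProduct_single]
  rw [Finset.sum_ite_eq, if_pos hs]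

lemma IsWhite.integral_sq {W : Matrix (Fin d) (Fin d) ℝ} {w : ℕ → Ω → Fin d → ℝ}
    (hw : IsWhite μ W w) (t : ℕ) : ∫ ω, w t ω ⬝ᵥ w t ω ∂μ = W.trace := by
  have := hw.integral_dotProduct_single (1 : Matrix (Fin d) (Fin d) ℝ) 1 t t
  simpa using this

/-- A filter applied to white noise. -/
lemma IsWhite.integral_sq_filt {W : Matrix (Fin d) (Fin d) ℝ} {w : ℕ → Ω → Fin d → ℝ}
    (hw : IsWhite μ W w) (p : Polynomial ℝ) (t : ℕ) :
    ∫ ω, filt p (fun s => w s ω) t ⬝ᵥ filt p (fun s => w s ω) t ∂μ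
      = (∑ j ∈ Finset.range (t + 1), p.coeff j ^ 2) * W.trace := by
  have e : ∀ ω, LQR.filt p (fun s => w s ω) t = ∑ s ∈ Finset.range (t + 1),
      (p.coeff (t - s) • (1 : Matrix (Fin d) (Fin d) ℝ)) *ᵥ w s ω := by
    intro ω
    rw [LQR.filt, ← Finset.sum_range_reflect]
    refine Finset.sum_congr rfl fun j hj => ?_
    have := Finset.mem_range.1 hj
    rw [smul_mulVec, one_mulVec, show t + 1 - 1 - j = t - j by omega,
      show t - (t - j) = j by omega]
  simp only [e]
  rw [hw.integral_dotProduct, ← Finset.sum_range_reflect, Finset.sum_mul]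
  refine Finset.sum_congr rfl fun j hj => ?_
  have := Finset.mem_range.1 hj
  rw [show t + 1 - 1 - j = t - j by omega, show t - (t - j) = j by omega]
  simp [sq, mul_assoc]

/-- Independent identically distributed centred square integrable noise is white. -/
lemma isWhite_of_iid [IsProbabilityMeasure μ] {w : ℕ → Ω → Fin d → ℝ}
    (hindep : iIndepFun w μ) (hident : ∀ t, IdentDistrib (w t) (w 0) μ μ)
    (hL2 : MemLp (w 0) 2 μ) (hmean : ∫ ω, w 0 ω ∂μ = 0) : IsWhite μ (covMatrix μ (w 0)) w := by
  have hid : ∀ t i, IdentDistrib (fun ω => w t ω i) (fun ω => w 0 ω i) μ μ := fun t i =>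
    (hident t).comp (measurable_pi_apply i)
  have h0 : L2vec μ (w 0) := fun i => hL2.eval i
  have hl2 : ∀ t, L2vec μ (w t) := fun t i => (hid t i).memLp_iff.2 (h0 i)
  have hm0 : ∀ i, ∫ ω, w 0 ω i ∂μ = 0 := fun i => by
    have h := eval_integral (μ := μ) (f := w 0) (fun i => (h0 i).integrable (by norm_num)) i
    rw [← h, hmean, Pi.zero_apply]
  have hm : ∀ t i, ∫ ω, w t ω i ∂μ = 0 := fun t i => by rw [(hid t i).integral_eq, hm0]
  refine ⟨hl2, fun s t i j => ?_⟩
  split_ifs with h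
  · subst h
    have hc : IdentDistrib (fun ω => w s ω i * w s ω j) (fun ω => w 0 ω i * w 0 ω j) μ μ :=
      (hident s).comp (u := fun x : Fin d → ℝ => x i * x j)
        ((measurable_pi_apply i).mul (measurable_pi_apply j))
    rw [hc.integral_eq, covMatrix, of_apply, covariance, hm0, hm0]
    simp
  · have hi : IndepFun (fun ω => w s ω i) (fun ω => w t ω j) μ :=
      (hindep.indepFun h).comp (measurable_pi_apply i) (measurable_pi_apply j)
    have := hi.integral_mul_eq_mul_integral (hl2 s i).1 (hl2 t j).1
    simp only [Pi.mul_apply] at this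
    rw [this, hm, zero_mul]

end Vector

end

end LQR

namespace LQR

noncomputable section

/-! ### The expected optimal cost -/

variable {n m : ℕ} (A : Matrix (Fin n) (Fin n) ℝ) (B : Matrix (Fin n) (Fin m) ℝ)
    (Q : Matrix (Fin n) (Fin n) ℝ) (R : Matrix (Fin m) (Fin m) ℝ)
    (Qf : Matrix (Fin n) (Fin n) ℝ)

/-- A vector depending linearly on the first `T` noise vectors. -/
def LinRep {d : ℕ} (T : ℕ) (X : (ℕ → Fin n → ℝ) → Fin d → ℝ) : Prop :=
  ∃ G : ℕ → Matrix (Fin d) (Fin n) ℝ, ∀ w, X w = ∑ s ∈ Finset.range T, G s *ᵥ w s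

lemma LinRep.eval {T t : ℕ} (ht : t < T) : LinRep (n := n) T (fun w => w t) :=
  ⟨fun s => if s = t then 1 else 0, fun w => by
    rw [Finset.sum_eq_single_of_mem t (Finset.mem_range.2 ht)]
    · simp
    · intro s _ hs; simp [hs]⟩

lemma LinRep.add {d T : ℕ} {X Y : (ℕ → Fin n → ℝ) → Fin d → ℝ} (hX : LinRep T X)
    (hY : LinRep T Y) : LinRep T (fun w => X w + Y w) := by
  obtain ⟨G, hG⟩ := hX
  obtain ⟨H, hH⟩ := hY
  exact ⟨fun s => G s + H s, fun w => by simp [hG, hH, add_mulVec, Finset.sum_add_distrib]⟩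

lemma LinRep.mulVec {d e T : ℕ} {X : (ℕ → Fin n → ℝ) → Fin d → ℝ} (hX : LinRep T X)
    (N : Matrix (Fin e) (Fin d) ℝ) : LinRep T (fun w => N *ᵥ X w) := by
  obtain ⟨G, hG⟩ := hX
  exact ⟨fun s => N * G s, fun w => by simp [hG, mulVec_sum, mulVec_mulVec]⟩

lemma linRep_costate {T : ℕ} (hT : 0 < T) (k : ℕ) :
    LinRep T (fun w => costate A B Q R Qf T w k) := by
  induction k with
  | zero => exact ⟨0, fun w => by simp [costate]⟩
  | succ k ih =>
    exact (((LinRep.eval (by omega : T - 1 - k < T)).mulVec _).add ih).mulVec _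

variable {Ω : Type*} [MeasurableSpace Ω] {μ : Measure Ω}

/-- Second moments of linear functions of white noise depend only on the covariance matrix. -/
lemma LinRep.integral_eq {d T : ℕ} {X Y : (ℕ → Fin n → ℝ) → Fin d → ℝ} (hX : LinRep T X)
    (hY : LinRep T Y) {W : Matrix (Fin n) (Fin n) ℝ} {w w' : ℕ → Ω → Fin n → ℝ}
    (hw : IsWhite μ W w) (hw' : IsWhite μ W w') :
    ∫ ω, X (fun t => w t ω) ⬝ᵥ Y (fun t => w t ω) ∂μ
      = ∫ ω, X (fun t => w' t ω) ⬝ᵥ Y (fun t => w' t ω) ∂μ := by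
  obtain ⟨G, hG⟩ := hX
  obtain ⟨H, hH⟩ := hY
  simp only [hG, hH]
  rw [hw.integral_dotProduct, hw'.integral_dotProduct]

lemma integrable_stepCost {v w : Ω → Fin n → ℝ} (hv : L2vec μ v) (hw : L2vec μ w)
    (P : Matrix (Fin n) (Fin n) ℝ) : Integrable (fun ω => stepCost B R P (v ω) (w ω)) μ := by
  have hb := ((hw.mulVec P).add hv).mulVec Bᵀ
  exact ((hw.integrable_dotProduct (hw.mulVec P)).add
    ((hv.integrable_dotProduct hw).const_mul 2)).sub (hb.integrable_dotProduct (hb.mulVec _))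

lemma integral_stepCost {v w : Ω → Fin n → ℝ} (hv : L2vec μ v) (hw : L2vec μ w)
    (P : Matrix (Fin n) (Fin n) ℝ) :
    ∫ ω, stepCost B R P (v ω) (w ω) ∂μ = ∫ ω, w ω ⬝ᵥ P *ᵥ w ω ∂μ + 2 * ∫ ω, v ω ⬝ᵥ w ω ∂μ
      - ∫ ω, (Bᵀ *ᵥ (P *ᵥ w ω + v ω)) ⬝ᵥ
          (R + Bᵀ * P * B)⁻¹ *ᵥ (Bᵀ *ᵥ (P *ᵥ w ω + v ω)) ∂μ := by
  have hb := ((hw.mulVec P).add hv).mulVec Bᵀ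
  have h1 := hw.integrable_dotProduct (hw.mulVec P)
  have h2 := (hv.integrable_dotProduct hw).const_mul 2
  have h3 := hb.integrable_dotProduct (hb.mulVec (R + Bᵀ * P * B)⁻¹)
  simp only [stepCost]
  refine (integral_sub (h1.add h2) h3).trans ?_
  rw [← integral_const_mul, ← integral_add h1 h2]
  rfl

lemma l2vec_costate {w : ℕ → Ω → Fin n → ℝ} (hw : ∀ t, L2vec μ (w t)) (T k : ℕ) :
    L2vec μ (fun ω => costate A B Q R Qf T (fun t => w t ω) k) := by
  induction k with
  | zero => exact L2vec.zero
  | succ k ih => exact (((hw _).mulVec _).add ih).mulVec _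

lemma integrable_optValue {w : ℕ → Ω → Fin n → ℝ} (hw : ∀ t, L2vec μ (w t)) (T : ℕ) :
    Integrable (fun ω => optValue A B Q R Qf T fun t => w t ω) μ := by
  simp only [optValue]
  exact integrable_finsetSum _ fun t _ =>
    integrable_stepCost B R (l2vec_costate A B Q R Qf hw T _) (hw t) _

lemma l2vec_feedback {w : ℕ → Ω → Fin n → ℝ} (hw : ∀ t, L2vec μ (w t)) (T k : ℕ)
    {x : Ω → Fin n → ℝ} (hx : L2vec μ x) :
    L2vec μ (fun ω => feedback A B Q R Qf T (fun t => w t ω) k (x ω)) :=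
  (((((hx.mulVec A).add (hw _)).mulVec _).add (l2vec_costate A B Q R Qf hw T k)).mulVec _).mulVec _

lemma l2vec_optState {w : ℕ → Ω → Fin n → ℝ} (hw : ∀ t, L2vec μ (w t)) (T t : ℕ) :
    L2vec μ (fun ω => optState A B Q R Qf T (fun t => w t ω) t) := by
  induction t with
  | zero => exact L2vec.zero
  | succ t ih =>
    exact ((ih.mulVec A).add ((l2vec_feedback A B Q R Qf hw T _ ih).neg.mulVec B)).add (hw t)

/-- The expected optimal cost depends only on the covariance matrix of the noise. -/
lemma integral_optValue_eq {W : Matrix (Fin n) (Fin n) ℝ} {w w' : ℕ → Ω → Fin n → ℝ}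
    (hw : IsWhite μ W w) (hw' : IsWhite μ W w') (T : ℕ) :
    ∫ ω, optValue A B Q R Qf T (fun t => w t ω) ∂μ
      = ∫ ω, optValue A B Q R Qf T (fun t => w' t ω) ∂μ := by
  simp only [optValue]
  rw [integral_finsetSum _ fun t _ =>
      integrable_stepCost B R (l2vec_costate A B Q R Qf hw.l2 T _) (hw.l2 t) _,
    integral_finsetSum _ fun t _ =>
      integrable_stepCost B R (l2vec_costate A B Q R Qf hw'.l2 T _) (hw'.l2 t) _]
  refine Finset.sum_congr rfl fun t ht => ?_
  have ht' := Finset.mem_range.1 ht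
  rw [integral_stepCost B R (l2vec_costate A B Q R Qf hw.l2 T _) (hw.l2 t),
    integral_stepCost B R (l2vec_costate A B Q R Qf hw'.l2 T _) (hw'.l2 t)]
  have hl := linRep_costate A B Q R Qf (show 0 < T by omega) (T - 1 - t)
  have hx := LinRep.eval (n := n) ht'
  have hb := ((hx.mulVec (riccatiIter A B Q R Qf (T - 1 - t))).add hl).mulVec Bᵀ
  rw [LinRep.integral_eq hx (hx.mulVec (riccatiIter A B Q R Qf (T - 1 - t))) hw hw',
    LinRep.integral_eq hl hx hw hw',
    LinRep.integral_eq hb (hb.mulVec (R + Bᵀ * riccatiIter A B Q R Qf (T - 1 - t) * B)⁻¹) hw hw']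

/-! ### A solution of the Riccati equation as terminal weight -/

variable {A B Q R} {P : Matrix (Fin n) (Fin n) ℝ}

lemma IsRiccatiSolution.riccatiIter_eq (hP : IsRiccatiSolution A B Q R P) (k : ℕ) :
    riccatiIter A B Q R P k = P := by
  induction k with
  | zero => rfl
  | succ k ih => rw [riccatiIter, ih]; exact hP.2.symm

/-- Since all Riccati iterates equal P, the closed loop matrix is the same at each step and the
backward recursion unrolls into its powers. -/
lemma IsRiccatiSolution.costate_eq (hP : IsRiccatiSolution A B Q R P) {T : ℕ}
    (w : ℕ → Fin n → ℝ) {k : ℕ} (hk : k < T) :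
    P *ᵥ w (T - 1 - k) + costate A B Q R P T w k
      = ∑ i ∈ Finset.range (k + 1), ((closedLoop A B R P)ᵀ ^ i * P) *ᵥ w (T - 1 - k + i) := by
  induction k with
  | zero => simp [costate]
  | succ k ih =>
    rw [costate, hP.riccatiIter_eq, ih (by omega), Finset.sum_range_succ' _ (k + 1), mulVec_sum, add_comm]
    congr 1
    · refine Finset.sum_congr rfl fun i _ => ?_
      rw [mulVec_mulVec, pow_succ', Matrix.mul_assoc,
        show T - 1 - (k + 1) + (i + 1) = T - 1 - k + i by omega]
    · simp

/-- This identity translates the S A of the stated formula into the P L produced by dynamic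
programming, with L the closed loop. -/
lemma schurS_mul (A : Matrix (Fin n) (Fin n) ℝ) (B : Matrix (Fin n) (Fin m) ℝ)
    (R : Matrix (Fin m) (Fin m) ℝ) (P : Matrix (Fin n) (Fin n) ℝ) :
    schurS B R P * A = P * closedLoop A B R P := by
  simp only [schurS, closedLoop, kalmanGain, Matrix.sub_mul, Matrix.mul_sub, Matrix.mul_assoc]

lemma schurS_transpose (hR : R.PosDef) (hP : P.PosSemidef) : (schurS B R P)ᵀ = schurS B R P := by
  have hM := (posDef_add_form hR hP B).inv.posSemidef.transpose_eq
  rw [Matrix.mul_assoc] at hM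
  simp only [schurS, transpose_sub, transpose_mul, transpose_transpose, hP.transpose_eq,
    Matrix.mul_assoc, hM]

/-- The correction terms as second moments of the noise. -/
lemma offlineTerm_eq (hR : R.PosDef) (hP : P.PosSemidef) (W : Matrix (Fin n) (Fin n) ℝ) (i : ℕ) :
    offlineTerm A B R P W i = (W * ((Bᵀ * ((closedLoop A B R P)ᵀ ^ (i + 1) * P))ᵀ *
      ((R + Bᵀ * P * B)⁻¹ * (Bᵀ * ((closedLoop A B R P)ᵀ ^ (i + 1) * P))))).trace := by
  have h1 := schurS_mul A B R P
  have h2 : Aᵀ * schurS B R P = (closedLoop A B R P)ᵀ * P := by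
    have := congr_arg transpose h1
    rwa [transpose_mul, transpose_mul, schurS_transpose hR hP, hP.transpose_eq] at this
  have h3 : (Bᵀ * ((closedLoop A B R P)ᵀ ^ (i + 1) * P))ᵀ
      = schurS B R P * A * closedLoop A B R P ^ i * B := by
    rw [h1, transpose_mul, transpose_mul, transpose_transpose, hP.transpose_eq, transpose_pow,
      transpose_transpose, pow_succ', ← Matrix.mul_assoc]
  have h4 : (closedLoop A B R P)ᵀ ^ (i + 1) * P
      = (closedLoop A B R P)ᵀ ^ i * Aᵀ * schurS B R P := by
    rw [pow_succ, Matrix.mul_assoc, Matrix.mul_assoc, h2]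
  rw [h3, h4, offlineTerm]
  simp only [closedLoop, Matrix.mul_assoc]

/-- Each correction term is the expectation of a positive semidefinite form in the noise, with
weight (R + BᵀPB)⁻¹. -/
lemma offlineTerm_nonneg (hR : R.PosDef) (hP : P.PosSemidef) {W : Matrix (Fin n) (Fin n) ℝ}
    {w : ℕ → Ω → Fin n → ℝ} (hw : IsWhite μ W w) (i : ℕ) : 0 ≤ offlineTerm A B R P W i := by
  have h := hw.integral_dotProduct_single (Bᵀ * ((closedLoop A B R P)ᵀ ^ (i + 1) * P))
    ((R + Bᵀ * P * B)⁻¹ * (Bᵀ * ((closedLoop A B R P)ᵀ ^ (i + 1) * P))) 0 0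
  rw [if_pos rfl] at h
  rw [offlineTerm_eq hR hP, ← h]
  refine integral_nonneg fun ω => ?_
  simp only [← mulVec_mulVec]
  exact (posDef_add_form hR hP B).inv.posSemidef.form_nonneg _

/-- The vector P w_t + v is a combination of w_t, …, w_{T-1}, so its second moments are diagonal in
time. The present noise combines with P to give S, and each later noise vector gives one correction
term. -/
lemma IsRiccatiSolution.integral_stepCost (hR : R.PosDef) (hP : IsRiccatiSolution A B Q R P)
    {W : Matrix (Fin n) (Fin n) ℝ} {w : ℕ → Ω → Fin n → ℝ} (hw : IsWhite μ W w) {T t : ℕ}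
    (ht : t < T) :
    ∫ ω, stepCost B R P (costate A B Q R P T (fun t => w t ω) (T - 1 - t)) (w t ω) ∂μ
      = (W * schurS B R P).trace - ∑ i ∈ Finset.range (T - 1 - t), offlineTerm A B R P W i := by
  have hcs := l2vec_costate A B Q R P hw.l2 T (T - 1 - t)
  set L := closedLoop A B R P with hL
  set k := T - 1 - t with hk
  have hy : ∀ ω, P *ᵥ w t ω + costate A B Q R P T (fun t => w t ω) k
      = ∑ i ∈ Finset.range (k + 1), (Lᵀ ^ i * P) *ᵥ w (t + i) ω := by
    intro ω
    have := hP.costate_eq (T := T) (fun t => w t ω) (k := k) (by omega)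
    rwa [show T - 1 - k = t by omega] at this
  have hz := hw.shift t
  have h1 : ∫ ω, w t ω ⬝ᵥ P *ᵥ w t ω ∂μ = (W * P).trace := by
    have := hw.integral_dotProduct_single 1 P t t
    simpa using this
  have h2 : ∫ ω, (P *ᵥ w t ω + costate A B Q R P T (fun t => w t ω) k) ⬝ᵥ w t ω ∂μ
      = (W * P).trace := by
    have e : ∀ ω, w t ω = ∑ i ∈ Finset.range (k + 1),
        (if i = 0 then (1 : Matrix (Fin n) (Fin n) ℝ) else 0) *ᵥ w (t + i) ω := by
      intro ω
      rw [Finset.sum_range_succ']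
      simp
    have e' : ∀ ω, (P *ᵥ w t ω + costate A B Q R P T (fun t => w t ω) k) ⬝ᵥ w t ω
        = (∑ i ∈ Finset.range (k + 1), (Lᵀ ^ i * P) *ᵥ w (t + i) ω) ⬝ᵥ
          ∑ i ∈ Finset.range (k + 1),
            (if i = 0 then (1 : Matrix (Fin n) (Fin n) ℝ) else 0) *ᵥ w (t + i) ω := by
      intro ω
      rw [hy, ← e]
    simp only [e']
    rw [hz.integral_dotProduct, Finset.sum_range_succ']
    simp [hP.1.transpose_eq]
  -- The costate involves only noise after time t, so it is uncorrelated with w_t; this is read off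
  -- by subtracting `h1` from `h2`.
  have h3 : ∫ ω, costate A B Q R P T (fun t => w t ω) k ⬝ᵥ w t ω ∂μ = 0 := by
    have e : ∀ ω, (P *ᵥ w t ω + costate A B Q R P T (fun t => w t ω) k) ⬝ᵥ w t ω
        = w t ω ⬝ᵥ P *ᵥ w t ω + costate A B Q R P T (fun t => w t ω) k ⬝ᵥ w t ω := by
      intro ω
      rw [add_dotProduct, dotProduct_comm (P *ᵥ w t ω)]
    simp only [e] at h2
    rw [integral_add ((hw.l2 t).integrable_dotProduct ((hw.l2 t).mulVec P))
      (hcs.integrable_dotProduct (hw.l2 t)), h1] at h2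
    linarith
  have h4 : ∫ ω, (Bᵀ *ᵥ (P *ᵥ w t ω + costate A B Q R P T (fun t => w t ω) k)) ⬝ᵥ
      (R + Bᵀ * P * B)⁻¹ *ᵥ
        (Bᵀ *ᵥ (P *ᵥ w t ω + costate A B Q R P T (fun t => w t ω) k)) ∂μ
      = (W * (P * B * (R + Bᵀ * P * B)⁻¹ * Bᵀ * P)).trace
        + ∑ i ∈ Finset.range k, offlineTerm A B R P W i := by
    simp only [hy, mulVec_sum, mulVec_mulVec]
    rw [hz.integral_dotProduct, Finset.sum_range_succ', add_comm]
    congr 1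
    · simp only [pow_zero, Matrix.one_mul, transpose_mul, transpose_transpose, hP.1.transpose_eq,
        Matrix.mul_assoc]
    · exact Finset.sum_congr rfl fun i _ => (offlineTerm_eq hR hP.1 W i).symm
  rw [LQR.integral_stepCost B R hcs (hw.l2 t), h1, h3, h4, schurS, Matrix.mul_sub, trace_sub]
  ring

lemma IsRiccatiSolution.integral_optValue (hR : R.PosDef) (hP : IsRiccatiSolution A B Q R P)
    {W : Matrix (Fin n) (Fin n) ℝ} {w : ℕ → Ω → Fin n → ℝ} (hw : IsWhite μ W w) (T : ℕ) :
    ∫ ω, optValue A B Q R P T (fun t => w t ω) ∂μ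
      = ∑ k ∈ Finset.range T,
        ((W * schurS B R P).trace - ∑ i ∈ Finset.range k, offlineTerm A B R P W i) := by
  simp only [optValue, hP.riccatiIter_eq]
  rw [integral_finsetSum _ fun t _ =>
      integrable_stepCost B R (l2vec_costate A B Q R P hw.l2 T _) (hw.l2 t) _,
    ← Finset.sum_range_reflect (fun k => (W * schurS B R P).trace
      - ∑ i ∈ Finset.range k, offlineTerm A B R P W i)]
  exact Finset.sum_congr rfl fun t ht => hP.integral_stepCost hR hw (Finset.mem_range.1 ht)

/-- If the averages of a monotone sequence stay below a bound, so does the sequence. -/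
lemma le_of_sum_le {a : ℕ → ℝ} (ha : Monotone a) (ha0 : ∀ k, 0 ≤ a k) {b : ℝ}
    (h : ∀ T : ℕ, ∑ k ∈ Finset.range T, a k ≤ T * b) (K : ℕ) : a K ≤ b := by
  by_contra! hlt
  -- If a K > b, then after K + N terms with N(a K - b) > K a K the last N terms alone exceed the
  -- allowed total.
  obtain ⟨N, hN⟩ := exists_nat_gt (K * a K / (a K - b))
  have hd : 0 < a K - b := by linarith
  rw [div_lt_iff₀ hd] at hN
  have h1 : (N : ℝ) * a K ≤ ∑ k ∈ Finset.range (K + N), a k := by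
    rw [Finset.sum_range_add]
    have h2 : ∑ _k ∈ Finset.range N, a K ≤ ∑ k ∈ Finset.range N, a (K + k) :=
      Finset.sum_le_sum fun k _ => ha (by omega)
    rw [Finset.sum_const, Finset.card_range, nsmul_eq_mul] at h2
    have h3 : 0 ≤ ∑ k ∈ Finset.range K, a k := Finset.sum_nonneg fun k _ => ha0 k
    linarith
  have h2 := h (K + N)
  push_cast at h2
  have hK : (0 : ℝ) ≤ K := by positivity
  nlinarith

/-- The expected optimal value is nonnegative, so the partial sums are bounded by Tr(WS) on average
over the horizon. Being monotone, they are then bounded individually, without any decay of the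
closed loop powers. -/
theorem IsRiccatiSolution.summable_offlineTerm (hQ : Q.PosSemidef) (hR : R.PosDef)
    (hP : IsRiccatiSolution A B Q R P) {W : Matrix (Fin n) (Fin n) ℝ} {w : ℕ → Ω → Fin n → ℝ}
    (hw : IsWhite μ W w) : Summable (offlineTerm A B R P W) := by
  have h0 := offlineTerm_nonneg (A := A) (B := B) hR hP.1 hw
  refine summable_of_sum_range_le h0 (c := (W * schurS B R P).trace) ?_
  refine le_of_sum_le (fun a b hab => Finset.sum_le_sum_of_subset_of_nonneg
    (Finset.range_mono hab) fun i _ _ => h0 i) (fun k => Finset.sum_nonneg fun i _ => h0 i) ?_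
  intro T
  have h := hP.integral_optValue hR hw T
  have hnn : 0 ≤ ∫ ω, optValue A B Q R P T (fun t => w t ω) ∂μ :=
    integral_nonneg fun ω => optValue_nonneg A B Q R P hQ hR hP.1 T _
  rw [h, Finset.sum_sub_distrib, Finset.sum_const, Finset.card_range, nsmul_eq_mul] at hnn
  linarith

/-- The value divided by T is the Cesàro mean of Tr(WS) minus the partial sums of the convergent
series. -/
theorem IsRiccatiSolution.tendsto_optValue (hQ : Q.PosSemidef) (hR : R.PosDef)
    (hP : IsRiccatiSolution A B Q R P) {W : Matrix (Fin n) (Fin n) ℝ} {w : ℕ → Ω → Fin n → ℝ}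
    (hw : IsWhite μ W w) :
    Tendsto (fun T : ℕ => (T : ℝ)⁻¹ * ∫ ω, optValue A B Q R P T (fun t => w t ω) ∂μ) atTop
      (𝓝 ((W * schurS B R P).trace - ∑' i, offlineTerm A B R P W i)) := by
  simp only [hP.integral_optValue hR hw]
  exact (tendsto_const_nhds.sub
    (hP.summable_offlineTerm hQ hR hw).hasSum.tendsto_sum_nat).cesaro

end

end LQR

namespace LQR

noncomputable section

/-! ### The terminal weight does not matter on average -/

variable {n m : ℕ} {A : Matrix (Fin n) (Fin n) ℝ} {B : Matrix (Fin n) (Fin m) ℝ}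
    {Q : Matrix (Fin n) (Fin n) ℝ} {R : Matrix (Fin m) (Fin m) ℝ}
    {Y : Matrix (Fin n) (Fin n) ℝ}

/-- The optimal trajectory for the noise `z` without terminal weight, filtered and continued by a
stabilizing feedback, compared with the optimal trajectory for the noise `w` with terminal
weight `Y`. -/
lemma optValue_le_filtered (hQ : Q.PosSemidef) (hR : R.PosDef) (hY : Y.PosSemidef) {C : ℝ}
    (hstab : ∀ (w : ℕ → Fin n → ℝ) (u : ℕ → Fin m → ℝ) (s T : ℕ), s ≤ T →
      ∃ u', totalCost A B Q R Y T w u' ≤ runningCost A B Q R s w u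
        + state A B w u s ⬝ᵥ Y *ᵥ state A B w u s + C * ∑ t ∈ Finset.Ico s T, w t ⬝ᵥ w t)
    {p : Polynomial ℝ}
    (hp : ∀ (f : PowerSeries ℝ) (s : ℕ),
      ∑ t ∈ Finset.range s, PowerSeries.coeff t ((p : PowerSeries ℝ) * f) ^ 2
        ≤ ∑ t ∈ Finset.range s, PowerSeries.coeff t f ^ 2)
    {θ : ℝ} (hθ : 0 < θ) (w z : ℕ → Fin n → ℝ) {s T : ℕ} (hs : s ≤ T) :
    optValue A B Q R Y T w ≤ (1 + θ) * (optValue A B Q R 0 T z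
        + filt p (optState A B Q R 0 T z) s ⬝ᵥ Y *ᵥ filt p (optState A B Q R 0 T z) s
        + C * ∑ t ∈ Finset.Ico s T, w t ⬝ᵥ w t)
      + (1 + θ⁻¹) * (C * ∑ t ∈ Finset.range s, (w t - filt p z t) ⬝ᵥ (w t - filt p z t)) := by
  set u := optControl A B Q R 0 T z with hu
  have hx : state A B z u = optState A B Q R 0 T z := funext (state_optControl A B Q R 0 T z)
  -- Up to time s this is the noise that drives the filtered trajectory; afterwards it is the true
  -- noise, met by the stabilizing feedback.
  set w₁ : ℕ → Fin n → ℝ := fun t => if t < s then filt p z t else w t with hw₁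
  have hst : ∀ t ≤ s, state A B w₁ (filt p u) t = filt p (optState A B Q R 0 T z) t := by
    intro t ht
    rw [← hx, ← state_filt]
    exact state_congr_noise A B fun r hr => if_pos (by omega)
  obtain ⟨u₁, hu₁⟩ := hstab w₁ (filt p u) s T hs
  -- The discrepancy between the true noise and `w₁` is stabilized from time 0, starting at state 0,
  -- so its cost is only its energy.
  obtain ⟨u₂, hu₂⟩ := hstab (w - w₁) 0 0 T (Nat.zero_le _)
  have hrun : runningCost A B Q R s w₁ (filt p u) ≤ optValue A B Q R 0 T z := by
    calc runningCost A B Q R s w₁ (filt p u)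
        = ∑ t ∈ Finset.range s, filt p (optState A B Q R 0 T z) t ⬝ᵥ
              Q *ᵥ filt p (optState A B Q R 0 T z) t
            + ∑ t ∈ Finset.range s, filt p u t ⬝ᵥ R *ᵥ filt p u t := by
          rw [runningCost, Finset.sum_add_distrib]
          congr 1
          refine Finset.sum_congr rfl fun t ht => ?_
          rw [hst t (Finset.mem_range.1 ht).le]
      _ ≤ ∑ t ∈ Finset.range s, optState A B Q R 0 T z t ⬝ᵥ Q *ᵥ optState A B Q R 0 T z t
            + ∑ t ∈ Finset.range s, u t ⬝ᵥ R *ᵥ u t :=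
          add_le_add (sum_form_filt_le hp hQ _ s) (sum_form_filt_le hp hR.posSemidef _ s)
      _ = runningCost A B Q R s z u := by
          rw [runningCost, hx, Finset.sum_add_distrib]
      _ ≤ runningCost A B Q R T z u := runningCost_mono A B Q R hQ hR hs z u
      _ = optValue A B Q R 0 T z := by
          rw [← totalCost_zero, totalCost_optControl A B Q R 0 hQ hR .zero]
  have hIco : ∑ t ∈ Finset.Ico s T, w₁ t ⬝ᵥ w₁ t = ∑ t ∈ Finset.Ico s T, w t ⬝ᵥ w t := by
    refine Finset.sum_congr rfl fun t ht => ?_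
    have := (Finset.mem_Ico.1 ht).1
    simp only [hw₁, if_neg (show ¬ t < s by omega)]
  have hrange : ∑ t ∈ Finset.Ico 0 T, (w - w₁) t ⬝ᵥ (w - w₁) t
      = ∑ t ∈ Finset.range s, (w t - filt p z t) ⬝ᵥ (w t - filt p z t) := by
    rw [← Finset.range_eq_Ico]
    refine (Finset.sum_subset_zero_on_sdiff (Finset.range_mono hs) ?_ ?_).symm
    · intro t ht
      have : ¬ t < s := fun h => (Finset.mem_sdiff.1 ht).2 (Finset.mem_range.2 h)
      simp [hw₁, this]
    · intro t ht
      simp [hw₁, Finset.mem_range.1 ht]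
  have h0 : runningCost A B Q R 0 (w - w₁) 0
      + state A B (w - w₁) 0 0 ⬝ᵥ Y *ᵥ state A B (w - w₁) 0 0 = 0 := by
    simp [runningCost, state]
  rw [hrange, h0, zero_add] at hu₂
  rw [hIco, hst s le_rfl] at hu₁
  have hadd := totalCost_add_le A B Q R Y hQ hR hY hθ T w₁ (w - w₁) u₁ u₂
  rw [add_sub_cancel] at hadd
  refine (optValue_le_totalCost A B Q R Y hQ hR hY T w (u₁ + u₂)).trans (hadd.trans ?_)
  have hθ' : 0 < θ⁻¹ := inv_pos.2 hθ
  gcongr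
  linarith

variable {Ω : Type*} [MeasurableSpace Ω] {μ : Measure Ω}

/-- White noise is close to its filtered shift when the filter is close to the shift. -/
lemma IsWhite.integral_sq_sub_filt_le {W : Matrix (Fin n) (Fin n) ℝ} {w : ℕ → Ω → Fin n → ℝ}
    (hw : IsWhite μ W w) {p : Polynomial ℝ} {N : ℕ} {ε : ℝ}
    (hp : ∀ s : ℕ, ∑ t ∈ Finset.range s, (Polynomial.X ^ N - p).coeff t ^ 2 ≤ ε) (t : ℕ) :
    ∫ ω, (w t ω - filt p (fun r => w (N + r) ω) t) ⬝ᵥ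
        (w t ω - filt p (fun r => w (N + r) ω) t) ∂μ
      ≤ 2 * (if t < N then W.trace else 0) + 2 * (ε * W.trace) := by
  set q := Polynomial.X ^ N - p with hq
  have hz := hw.shift N
  have hW : 0 ≤ W.trace := by
    rw [← hw.integral_sq 0]
    exact integral_nonneg fun ω => Finset.sum_nonneg fun i _ => mul_self_nonneg _
  -- A delay by N undoes the advance by N except at times t < N, where it outputs 0. There the whole
  -- of w_t remains as error.
  set a : Ω → Fin n → ℝ := fun ω => if t < N then w t ω else 0 with ha
  set b : Ω → Fin n → ℝ := fun ω => filt q (fun r => w (N + r) ω) t with hb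
  have ha2 : L2vec μ a := by
    by_cases h : t < N
    · simpa [ha, h] using hw.l2 t
    · simpa [ha, h] using L2vec.zero
  have hb2 : L2vec μ b := L2vec.filt (fun s _ => hz.l2 s) q
  have hab : ∀ ω, w t ω - filt p (fun r => w (N + r) ω) t = a ω + b ω := by
    intro ω
    have h1 : b ω = filt (Polynomial.X ^ N) (fun r => w (N + r) ω) t
        - filt p (fun r => w (N + r) ω) t := by
      simp only [hb, hq, filt, Polynomial.coeff_sub, sub_smul, Finset.sum_sub_distrib]
    have h2 : filt (Polynomial.X ^ N) (fun r => w (N + r) ω) t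
        = if t < N then 0 else w t ω := by
      simp only [filt, Polynomial.coeff_X_pow, ite_smul, one_smul, zero_smul]
      rw [Finset.sum_ite_eq']
      by_cases h : t < N
      · rw [if_pos h, if_neg (by simp; omega)]
      · rw [if_neg h, if_pos (by simp; omega), show N + (t - N) = t by omega]
    rw [h1, h2, ha]
    by_cases h : t < N <;> simp [h, sub_eq_add_neg]
  have hle : ∀ x y : Fin n → ℝ, (x + y) ⬝ᵥ (x + y) ≤ 2 * (x ⬝ᵥ x) + 2 * (y ⬝ᵥ y) := by
    intro x y
    have := (PosSemidef.one (n := Fin n) (R := ℝ)).form_add_le one_pos x y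
    simp only [one_mulVec, inv_one] at this
    linarith
  simp only [hab]
  have hia := (ha2.integrable_dotProduct ha2).const_mul 2
  have hib := (hb2.integrable_dotProduct hb2).const_mul 2
  calc ∫ ω, (a ω + b ω) ⬝ᵥ (a ω + b ω) ∂μ
      ≤ ∫ ω, (2 * (a ω ⬝ᵥ a ω) + 2 * (b ω ⬝ᵥ b ω)) ∂μ :=
        integral_mono ((ha2.add hb2).integrable_dotProduct (ha2.add hb2)) (hia.add hib)
          fun ω => hle _ _
    _ = 2 * ∫ ω, a ω ⬝ᵥ a ω ∂μ + 2 * ∫ ω, b ω ⬝ᵥ b ω ∂μ := by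
        rw [integral_add hia hib, integral_const_mul, integral_const_mul]
    _ ≤ _ := by
        have h1 : ∫ ω, a ω ⬝ᵥ a ω ∂μ = if t < N then W.trace else 0 := by
          by_cases h : t < N
          · simpa [ha, h] using hw.integral_sq t
          · simp [ha, h]
        have h2 : ∫ ω, b ω ⬝ᵥ b ω ∂μ ≤ ε * W.trace := by
          rw [hb, hz.integral_sq_filt]
          exact mul_le_mul_of_nonneg_right (hp _) hW
        rw [h1]
        linarith


end

end LQR

/-! ### Expected cost comparison and asymptotic slopes -/

namespace LQR

noncomputable section

variable {n m : ℕ} {A : Matrix (Fin n) (Fin n) ℝ} {B : Matrix (Fin n) (Fin m) ℝ}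
    {Q : Matrix (Fin n) (Fin n) ℝ} {R : Matrix (Fin m) (Fin m) ℝ}
    {Y : Matrix (Fin n) (Fin n) ℝ} {Ω : Type*} [MeasurableSpace Ω] {μ : Measure Ω}

/-- Pigeonhole: among the last H values, one is at most the total divided by H. -/
lemma exists_mul_le_sum_Ico {f : ℕ → ℝ} (hf : ∀ t, 0 ≤ f t) {H T : ℕ} (hH : 0 < H) (hT : H ≤ T) :
    ∃ s, T - H ≤ s ∧ s < T ∧ H * f s ≤ ∑ t ∈ Finset.range T, f t := by
  by_contra! hcon
  have h1 : ∑ _t ∈ Finset.Ico (T - H) T, ∑ r ∈ Finset.range T, f r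
      < ∑ t ∈ Finset.Ico (T - H) T, H * f t :=
    Finset.sum_lt_sum_of_nonempty (by simp; omega) fun t ht =>
      hcon t (Finset.mem_Ico.1 ht).1 (Finset.mem_Ico.1 ht).2
  rw [Finset.sum_const, Nat.card_Ico, nsmul_eq_mul, ← Finset.mul_sum,
    show T - (T - H) = H by omega] at h1
  have h2 := lt_of_mul_lt_mul_left h1 (Nat.cast_nonneg H)
  have h3 : ∑ t ∈ Finset.Ico (T - H) T, f t ≤ ∑ t ∈ Finset.range T, f t :=
    Finset.sum_le_sum_of_subset_of_nonneg
      (fun t ht => Finset.mem_range.2 (Finset.mem_Ico.1 ht).2) fun t _ _ => hf t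
  linarith

/-- Up to a small fraction of the horizon, the terminal weight `Y` does not increase the expected
optimal cost. -/
theorem exists_integral_optValue_le (hQ : Q.PosSemidef) (hR : R.PosDef) (hY : Y.PosSemidef)
    {C : ℝ} (hC : 0 < C)
    (hstab : ∀ (w : ℕ → Fin n → ℝ) (u : ℕ → Fin m → ℝ) (s T : ℕ), s ≤ T →
      ∃ u', totalCost A B Q R Y T w u' ≤ runningCost A B Q R s w u
        + state A B w u s ⬝ᵥ Y *ᵥ state A B w u s + C * ∑ t ∈ Finset.Ico s T, w t ⬝ᵥ w t)
    {W : Matrix (Fin n) (Fin n) ℝ} {w : ℕ → Ω → Fin n → ℝ} (hw : IsWhite μ W w)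
    {η : ℝ} (hη : 0 < η) :
    ∃ D : ℝ, ∀ T : ℕ, ∫ ω, optValue A B Q R Y T (fun t => w t ω) ∂μ
      ≤ (1 + η) * ∫ ω, optValue A B Q R 0 T (fun t => w t ω) ∂μ + η * T + D := by
  set σ := W.trace with hσ
  have hσ0 : 0 ≤ σ := by
    rw [hσ, ← hw.integral_sq 0]
    exact integral_nonneg fun ω => Finset.sum_nonneg fun i _ => mul_self_nonneg _
  have hsq : ∀ {d : ℕ} (x : Fin d → ℝ), 0 ≤ x ⬝ᵥ x := fun x =>
    Finset.sum_nonneg fun i _ => mul_self_nonneg (x i)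
  have hη' : 0 < η⁻¹ := inv_pos.2 hη
  -- Using the stabilizing feedback from the start shows that costs grow at most linearly.
  have hlin : ∀ T : ℕ, ∫ ω, optValue A B Q R Y T (fun t => w t ω) ∂μ ≤ C * σ * T := by
    intro T
    have hint : ∀ t, Integrable (fun ω => w t ω ⬝ᵥ w t ω) μ := fun t =>
      (hw.l2 t).integrable_dotProduct (hw.l2 t)
    calc ∫ ω, optValue A B Q R Y T (fun t => w t ω) ∂μ
        ≤ ∫ ω, C * ∑ t ∈ Finset.range T, w t ω ⬝ᵥ w t ω ∂μ := by
          refine integral_mono (integrable_optValue A B Q R Y hw.l2 T)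
            ((integrable_finsetSum _ fun t _ => hint t).const_mul C) fun ω => ?_
          obtain ⟨u', hu'⟩ := hstab (fun t => w t ω) 0 0 T (Nat.zero_le _)
          refine (optValue_le_totalCost A B Q R Y hQ hR hY T _ u').trans (hu'.trans_eq ?_)
          rw [← Finset.range_eq_Ico]
          simp [runningCost, state]
      _ = _ := by
          rw [integral_const_mul, integral_finsetSum _ fun t _ => hint t]
          simp only [hw.integral_sq]
          rw [Finset.sum_const, Finset.card_range, nsmul_eq_mul]; ring
  have hzero : ∀ T : ℕ, ∫ ω, optValue A B Q R 0 T (fun t => w t ω) ∂μ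
      ≤ ∫ ω, optValue A B Q R Y T (fun t => w t ω) ∂μ := fun T =>
    integral_mono (integrable_optValue A B Q R 0 hw.l2 T) (integrable_optValue A B Q R Y hw.l2 T)
      fun ω => optValue_mono A B Q R hQ hR .zero hY (fun x => by simpa using hY.form_nonneg x) T _
  -- The constant term of det(1 - XA) is 1.
  have hχ : A.charpolyRev ≠ 0 := by
    intro h
    have := eval_charpolyRev (M := A)
    rw [h] at this
    simp at this
  -- Chosen so that the noise mismatch costs at most (η/2)T; using σ + 1 avoids division by zero
  -- when the noise vanishes.
  set ε := η / (4 * ((1 + η⁻¹) * C * (σ + 1))) with hε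
  have hε0 : 0 < ε := by positivity
  obtain ⟨p₀, N, hcontr, hsmall⟩ := exists_filter hχ hε0
  obtain ⟨c₁, hc₁, hfir⟩ := exists_sum_filt_state_le A B p₀
  set p := A.charpolyRev * p₀ with hp
  obtain ⟨c₂, hc₂, hRle⟩ := hR.exists_le_form
  obtain ⟨c₃, hc₃, hYle⟩ := exists_form_le Y
  -- The mean energy of the filtered state over the horizon is at most c₄T, since controls are paid
  -- for through R and the optimal cost is at most CσT.
  set c₄ := c₁ * (c₂ * (C * σ) + σ) with hc₄
  have hc₄0 : 0 ≤ c₄ := by positivity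
  -- Some time among the last H has mean filtered energy at most c₄T/H; this H makes its
  -- stabilization cost at most (η/2)T.
  obtain ⟨H, hH⟩ := exists_nat_gt (2 * (1 + η) * c₃ * c₄ / η)
  have hH0 : 0 < H := by
    have : (0 : ℝ) < H := lt_of_le_of_lt (by positivity) hH
    exact_mod_cast this
  have hHr : (0 : ℝ) < H := by exact_mod_cast hH0
  -- The three parts of D cover horizons shorter than H, the noise of the last at most H steps, and
  -- the first N steps where the delayed noise is missing.
  refine ⟨C * σ * H + (1 + η) * (C * (H * σ)) + (1 + η⁻¹) * (C * (2 * (N * σ))), fun T => ?_⟩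
  have hj0 : 0 ≤ ∫ ω, optValue A B Q R 0 T (fun t => w t ω) ∂μ :=
    integral_nonneg fun ω => optValue_nonneg A B Q R 0 hQ hR .zero T _
  rcases lt_or_ge T H with hTH | hTH
  · have h1 : C * σ * T ≤ C * σ * H := by
      have : (T : ℝ) ≤ H := by exact_mod_cast hTH.le
      gcongr
    have h2 : 0 ≤ (1 + η) * ∫ ω, optValue A B Q R 0 T (fun t => w t ω) ∂μ := by positivity
    have h3 : 0 ≤ (1 + η) * (C * (H * σ)) + (1 + η⁻¹) * (C * (2 * (N * σ))) := by positivity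
    have h4 : 0 ≤ η * T := by positivity
    linarith [hlin T]
  have hz := hw.shift N
  have hjz := integral_optValue_eq A B Q R 0 hz hw T
  set z : Ω → ℕ → Fin n → ℝ := fun ω t => w (N + t) ω with hzdef
  set y : ℕ → Ω → Fin n → ℝ := fun t ω => filt p (optState A B Q R 0 T (z ω)) t with hy
  have hy2 : ∀ t, L2vec μ (y t) := fun t =>
    L2vec.filt (fun s _ => l2vec_optState A B Q R 0 hz.l2 T s) p
  have hyint : ∀ t, Integrable (fun ω => y t ω ⬝ᵥ y t ω) μ := fun t =>
    (hy2 t).integrable_dotProduct (hy2 t)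
  have hzint : ∀ t, Integrable (fun ω => z ω t ⬝ᵥ z ω t) μ := fun t =>
    (hz.l2 t).integrable_dotProduct (hz.l2 t)
  have hVint : Integrable (fun ω => optValue A B Q R 0 T (z ω)) μ :=
    integrable_optValue A B Q R 0 hz.l2 T
  have hysum : ∑ t ∈ Finset.range T, ∫ ω, y t ω ⬝ᵥ y t ω ∂μ ≤ c₄ * T := by
    have hpt : ∀ ω, ∑ t ∈ Finset.range T, y t ω ⬝ᵥ y t ω
        ≤ c₁ * (c₂ * optValue A B Q R 0 T (z ω) + ∑ t ∈ Finset.range T, z ω t ⬝ᵥ z ω t) := by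
      intro ω
      set u := optControl A B Q R 0 T (z ω) with hu
      have hx : state A B (z ω) u = optState A B Q R 0 T (z ω) :=
        funext (state_optControl A B Q R 0 T (z ω))
      have h1 := hfir (z ω) u T
      rw [hx, Finset.sum_add_distrib] at h1
      refine h1.trans ?_
      gcongr
      rw [← totalCost_optControl A B Q R 0 hQ hR .zero, totalCost_zero, runningCost,
        Finset.mul_sum]
      refine Finset.sum_le_sum fun t _ => ?_
      have h2 := hRle (u t)
      have h3 := mul_nonneg hc₂.le (hQ.form_nonneg (state A B (z ω) u t))
      rw [← hu]
      linarith
    rw [← integral_finsetSum _ fun t _ => hyint t]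
    calc ∫ ω, ∑ t ∈ Finset.range T, y t ω ⬝ᵥ y t ω ∂μ
        ≤ ∫ ω, c₁ * (c₂ * optValue A B Q R 0 T (z ω)
            + ∑ t ∈ Finset.range T, z ω t ⬝ᵥ z ω t) ∂μ :=
          integral_mono (integrable_finsetSum _ fun t _ => hyint t)
            (((hVint.const_mul c₂).add (integrable_finsetSum _ fun t _ => hzint t)).const_mul c₁) hpt
      _ = c₁ * (c₂ * ∫ ω, optValue A B Q R 0 T (fun t => w t ω) ∂μ + T * σ) := by
          rw [integral_const_mul, integral_add (hVint.const_mul c₂)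
            (integrable_finsetSum _ fun t _ => hzint t), integral_const_mul, hjz,
            integral_finsetSum _ fun t _ => hzint t]
          simp only [hzdef, hz.integral_sq]
          rw [Finset.sum_const, Finset.card_range, nsmul_eq_mul]
      _ ≤ c₁ * (c₂ * (C * σ * T) + T * σ) := by
          gcongr
          exact (hzero T).trans (hlin T)
      _ = _ := by rw [hc₄]; ring
  -- The switching time is selected from expectations, so it is the same for every realization and
  -- the pointwise bound can be integrated.
  obtain ⟨s, hs1, hs2, hs3⟩ := exists_mul_le_sum_Ico
    (f := fun t => ∫ ω, y t ω ⬝ᵥ y t ω ∂μ) (fun t => integral_nonneg fun ω => hsq _) hH0 hTH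
  have hys : (1 + η) * (c₃ * ∫ ω, y s ω ⬝ᵥ y s ω ∂μ) ≤ η / 2 * T := by
    have h1 : ∫ ω, y s ω ⬝ᵥ y s ω ∂μ ≤ c₄ * T / H := by
      rw [le_div_iff₀ hHr]
      linarith
    rw [div_lt_iff₀ hη] at hH
    calc (1 + η) * (c₃ * ∫ ω, y s ω ⬝ᵥ y s ω ∂μ) ≤ (1 + η) * (c₃ * (c₄ * T / H)) := by gcongr
      _ = (2 * (1 + η) * c₃ * c₄) * (T / (2 * H)) := by field_simp
      _ ≤ (H * η) * (T / (2 * H)) := by gcongr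
      _ = _ := by field_simp
  set e : ℕ → Ω → Fin n → ℝ := fun t ω => w t ω - filt p (z ω) t with he
  have he2 : ∀ t, L2vec μ (e t) := fun t => (hw.l2 t).sub (L2vec.filt (fun s _ => hz.l2 s) p)
  have heint : ∀ t, Integrable (fun ω => e t ω ⬝ᵥ e t ω) μ := fun t =>
    (he2 t).integrable_dotProduct (he2 t)
  have hesum : ∑ t ∈ Finset.range s, ∫ ω, e t ω ⬝ᵥ e t ω ∂μ ≤ 2 * (N * σ) + 2 * ε * σ * T := by
    calc ∑ t ∈ Finset.range s, ∫ ω, e t ω ⬝ᵥ e t ω ∂μ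
        ≤ ∑ t ∈ Finset.range s, (2 * (if t < N then σ else 0) + 2 * (ε * σ)) :=
          Finset.sum_le_sum fun t _ => hw.integral_sq_sub_filt_le hsmall t
      _ = 2 * ∑ t ∈ Finset.range s, (if t < N then σ else 0) + s * (2 * (ε * σ)) := by
          rw [Finset.sum_add_distrib, ← Finset.mul_sum, Finset.sum_const, Finset.card_range,
            nsmul_eq_mul]
      _ ≤ 2 * (N * σ) + T * (2 * (ε * σ)) := by
          have hsT : (s : ℝ) ≤ T := by exact_mod_cast hs2.le
          gcongr
          rw [← Finset.sum_filter]
          calc ∑ t ∈ Finset.range s with t < N, σ ≤ ∑ t ∈ Finset.range N, σ :=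
                Finset.sum_le_sum_of_subset_of_nonneg
                  (fun t ht => Finset.mem_range.2 (Finset.mem_filter.1 ht).2) fun _ _ _ => hσ0
            _ = _ := by rw [Finset.sum_const, Finset.card_range, nsmul_eq_mul]
      _ = _ := by ring
  have hwint : ∀ t, Integrable (fun ω => w t ω ⬝ᵥ w t ω) μ := fun t =>
    (hw.l2 t).integrable_dotProduct (hw.l2 t)
  have htail : ∑ t ∈ Finset.Ico s T, ∫ ω, w t ω ⬝ᵥ w t ω ∂μ ≤ H * σ := by
    simp only [hw.integral_sq]
    rw [Finset.sum_const, Nat.card_Ico, nsmul_eq_mul]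
    have : ((T - s : ℕ) : ℝ) ≤ H := by exact_mod_cast (by omega : T - s ≤ H)
    gcongr
  have hpt : ∀ ω, optValue A B Q R Y T (fun t => w t ω)
      ≤ ((1 + η) * optValue A B Q R 0 T (z ω) + (1 + η) * c₃ * (y s ω ⬝ᵥ y s ω))
        + ((1 + η) * C * ∑ t ∈ Finset.Ico s T, w t ω ⬝ᵥ w t ω
          + (1 + η⁻¹) * C * ∑ t ∈ Finset.range s, e t ω ⬝ᵥ e t ω) := by
    intro ω
    have h := optValue_le_filtered hQ hR hY hstab hcontr hη (fun t => w t ω) (z ω) hs2.le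
    have h2 := hYle (y s ω)
    have h3 : (1 + η) * (y s ω ⬝ᵥ Y *ᵥ y s ω) ≤ (1 + η) * (c₃ * (y s ω ⬝ᵥ y s ω)) := by gcongr
    simp only [hy, he] at h3 ⊢
    linarith
  have hi1 := hVint.const_mul (1 + η)
  have hi2 := (hyint s).const_mul ((1 + η) * c₃)
  have hi3 := (integrable_finsetSum (Finset.Ico s T) fun t _ => hwint t).const_mul ((1 + η) * C)
  have hi4 := (integrable_finsetSum (Finset.range s) fun t _ => heint t).const_mul ((1 + η⁻¹) * C)
  have hmain := integral_mono (integrable_optValue A B Q R Y hw.l2 T)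
    ((hi1.add hi2).add (hi3.add hi4)) hpt
  have hev : ∫ ω, (((fun ω => (1 + η) * optValue A B Q R 0 T (z ω))
      + fun ω => (1 + η) * c₃ * (y s ω ⬝ᵥ y s ω))
        + ((fun ω => (1 + η) * C * ∑ t ∈ Finset.Ico s T, w t ω ⬝ᵥ w t ω)
          + fun ω => (1 + η⁻¹) * C * ∑ t ∈ Finset.range s, e t ω ⬝ᵥ e t ω)) ω ∂μ
      = (1 + η) * ∫ ω, optValue A B Q R 0 T (fun t => w t ω) ∂μ
        + (1 + η) * c₃ * ∫ ω, y s ω ⬝ᵥ y s ω ∂μ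
        + ((1 + η) * C * ∑ t ∈ Finset.Ico s T, ∫ ω, w t ω ⬝ᵥ w t ω ∂μ
          + (1 + η⁻¹) * C * ∑ t ∈ Finset.range s, ∫ ω, e t ω ⬝ᵥ e t ω ∂μ) := by
    rw [integral_add' (hi1.add hi2) (hi3.add hi4), integral_add' hi1 hi2, integral_add' hi3 hi4,
      integral_const_mul, integral_const_mul, integral_const_mul, integral_const_mul, hjz,
      integral_finsetSum _ fun t _ => hwint t, integral_finsetSum _ fun t _ => heint t]
  have hmain' := hmain.trans_eq hev
  have h5 : (1 + η) * C * ∑ t ∈ Finset.Ico s T, ∫ ω, w t ω ⬝ᵥ w t ω ∂μ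
      ≤ (1 + η) * C * (H * σ) := by gcongr
  have h6 : (1 + η⁻¹) * C * ∑ t ∈ Finset.range s, ∫ ω, e t ω ⬝ᵥ e t ω ∂μ
      ≤ (1 + η⁻¹) * C * (2 * (N * σ) + 2 * ε * σ * T) := by gcongr
  have h7 : (1 + η⁻¹) * C * (2 * ε * σ * T) ≤ η / 2 * T := by
    have h8 : (1 + η⁻¹) * C * (2 * ε * σ) ≤ (1 + η⁻¹) * C * (2 * ε * (σ + 1)) := by
      gcongr; linarith
    have h9 : (1 + η⁻¹) * C * (2 * ε * (σ + 1)) = η / 2 := by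
      rw [hε]; field_simp; norm_num
    calc (1 + η⁻¹) * C * (2 * ε * σ * T) = ((1 + η⁻¹) * C * (2 * ε * σ)) * T := by ring
      _ ≤ η / 2 * T := by gcongr; linarith
  have h10 : 0 ≤ C * σ * H := by positivity
  linarith

/-- Sequences which agree up to a factor close to `1` and a sublinear error have the same
asymptotic slope. -/
lemma tendsto_slope_of_comparable {a b : ℕ → ℝ} {l : ℝ} (ha0 : ∀ T, 0 ≤ a T)
    (ha : Tendsto (fun T : ℕ => (T : ℝ)⁻¹ * a T) atTop (𝓝 l))
    (hba : ∀ η : ℝ, 0 < η → ∃ D, ∀ T : ℕ, b T ≤ (1 + η) * a T + η * T + D)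
    (hab : ∀ η : ℝ, 0 < η → ∃ D, ∀ T : ℕ, a T ≤ (1 + η) * b T + η * T + D) :
    Tendsto (fun T : ℕ => (T : ℝ)⁻¹ * b T) atTop (𝓝 l) := by
  have hl : 0 ≤ l := ge_of_tendsto' ha fun T => mul_nonneg (by positivity) (ha0 T)
  have hD : ∀ D : ℝ, Tendsto (fun T : ℕ => (T : ℝ)⁻¹ * D) atTop (𝓝 0) := fun D => by
    simpa using (tendsto_inv_atTop_nhds_zero_nat (𝕜 := ℝ)).mul_const D
  refine tendsto_order.2 ⟨fun r hr => ?_, fun r hr => ?_⟩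
  · obtain ⟨η, hη, hηr⟩ : ∃ η : ℝ, 0 < η ∧ (1 + η) * r + η < l := by
      have hr1 : 0 < |r| + 1 := by positivity
      -- This gives (1 + η)r + η ≤ r + η(|r| + 1) = (r + l)/2 < l.
      refine ⟨(l - r) / (2 * (|r| + 1)), div_pos (by linarith) (by positivity), ?_⟩
      set η := (l - r) / (2 * (|r| + 1)) with hη
      have h1 : η * (|r| + 1) = (l - r) / 2 := by rw [hη]; field_simp
      have h2 : 0 < η := div_pos (by linarith) (by positivity)
      nlinarith [le_abs_self r]
    obtain ⟨D, hD'⟩ := hab η hη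
    have h := (ha.sub (hD D)).eventually (lt_mem_nhds (show (1 + η) * r + η < l - 0 by linarith))
    filter_upwards [h, eventually_gt_atTop 0] with T hT hT0
    have hT0' : (0 : ℝ) < T := by exact_mod_cast hT0
    have h1 : (T : ℝ)⁻¹ * a T ≤ (T : ℝ)⁻¹ * ((1 + η) * b T + η * T + D) := by
      gcongr; exact hD' T
    have h2 : (T : ℝ)⁻¹ * ((1 + η) * b T + η * T + D)
        = (1 + η) * ((T : ℝ)⁻¹ * b T) + η + (T : ℝ)⁻¹ * D := by field_simp
    have h3 : (1 + η) * r < (1 + η) * ((T : ℝ)⁻¹ * b T) := by linarith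
    exact lt_of_mul_lt_mul_left h3 (by linarith)
  · set η := (r - l) / (2 * (l + 1)) with hη
    have hη0 : 0 < η := div_pos (by linarith) (by positivity)
    have h1 : η * (l + 1) = (r - l) / 2 := by
      have : l + 1 ≠ 0 := by positivity
      rw [hη]; field_simp
    obtain ⟨D, hD'⟩ := hba η hη0
    have h := (((ha.const_mul (1 + η)).add_const η).add (hD D)).eventually
      (gt_mem_nhds (show (1 + η) * l + η + 0 < r by linarith))
    filter_upwards [h, eventually_gt_atTop 0] with T hT hT0
    have hT0' : (0 : ℝ) < T := by exact_mod_cast hT0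
    refine lt_of_le_of_lt ?_ hT
    calc (T : ℝ)⁻¹ * b T ≤ (T : ℝ)⁻¹ * ((1 + η) * a T + η * T + D) := by
          gcongr; exact hD' T
      _ = _ := by field_simp

end

end LQR

/-! ### The infinite-horizon cost of the offline optimum -/

theorem mainTheorem2 {n m : ℕ}
    (A : Matrix (Fin n) (Fin n) ℝ) (B : Matrix (Fin n) (Fin m) ℝ)
    (Q : Matrix (Fin n) (Fin n) ℝ) (R : Matrix (Fin m) (Fin m) ℝ)
    (Qf : Matrix (Fin n) (Fin n) ℝ)
    (hAB : LQR.Stabilizable A B) (hQ : Q.PosSemidef) (hR : R.PosDef) (hQf : Qf.PosSemidef)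
    (P : Matrix (Fin n) (Fin n) ℝ) (hP : LQR.IsRiccatiSolution A B Q R P)
    {Ω : Type*} [MeasurableSpace Ω] (μ : Measure Ω) [IsProbabilityMeasure μ]
    (w : ℕ → Ω → Fin n → ℝ)
    (hindep : iIndepFun w μ)
    (hident : ∀ t, IdentDistrib (w t) (w 0) μ μ)
    (hL2 : MemLp (w 0) 2 μ)
    (hmean : ∫ ω, w 0 ω ∂μ = 0)
    (W : Matrix (Fin n) (Fin n) ℝ) (hW : W = LQR.covMatrix μ (w 0)) :
    -- the optimal offline control actions exist and are unique
    (∀ (T : ℕ) (z : ℕ → Fin n → ℝ),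
      ∃ u : ℕ → Fin m → ℝ, LQR.IsOptimalOffline A B Q R Qf T z u ∧
        ∀ u' : ℕ → Fin m → ℝ, LQR.IsOptimalOffline A B Q R Qf T z u' → ∀ t < T, u' t = u t) ∧
    -- the series converges
    Summable (LQR.offlineTerm A B R P W) ∧
    -- the optimal offline policy has the stated infinite-horizon cost, and the terminal cost
    -- does not contribute to it
    ∀ ustar : ℕ → Ω → ℕ → Fin m → ℝ,
      (∀ T ω, LQR.IsOptimalOffline A B Q R Qf T (fun t => w t ω) (ustar T ω)) →
      (∀ T : ℕ, Integrable
          (fun ω => LQR.runningCost A B Q R T (fun t => w t ω) (ustar T ω)) μ) ∧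
      Tendsto
        (fun T : ℕ =>
          ∫ ω, (1 / (T : ℝ)) * LQR.runningCost A B Q R T (fun t => w t ω) (ustar T ω) ∂μ)
        atTop
        (𝓝 ((W * LQR.schurS B R P).trace - ∑' i, LQR.offlineTerm A B R P W i)) ∧
      (∀ T : ℕ, Integrable
          (fun ω => LQR.totalCost A B Q R Qf T (fun t => w t ω) (ustar T ω)) μ) ∧
      Tendsto
        (fun T : ℕ =>
          ∫ ω, (1 / (T : ℝ)) * LQR.totalCost A B Q R Qf T (fun t => w t ω) (ustar T ω) ∂μ)
        atTop
        (𝓝 ((W * LQR.schurS B R P).trace - ∑' i, LQR.offlineTerm A B R P W i)) := by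
  have hw : LQR.IsWhite μ W w := hW ▸ LQR.isWhite_of_iid hindep hident hL2 hmean
  refine ⟨fun T z => ⟨LQR.optControl A B Q R Qf T z,
    LQR.isOptimalOffline_optControl A B Q R Qf hQ hR hQf T z,
    fun u' hu' => (hu'.eq_opt hQ hR hQf).1⟩, hP.summable_offlineTerm hQ hR hw, ?_⟩
  intro ustar hopt
  obtain ⟨Y, hY, hQfY, hPY, C, hC, hstab⟩ := LQR.exists_stabilizing_weight A B Q R Qf hAB P
  have htot : ∀ T ω, LQR.totalCost A B Q R Qf T (fun t => w t ω) (ustar T ω)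
      = LQR.optValue A B Q R Qf T (fun t => w t ω) := fun T ω =>
    (hopt T ω).totalCost_eq_optValue hQ hR hQf
  have hTint : ∀ T : ℕ, Integrable
      (fun ω => LQR.totalCost A B Q R Qf T (fun t => w t ω) (ustar T ω)) μ := fun T => by
    simp only [htot]
    exact LQR.integrable_optValue A B Q R Qf hw.l2 T
  have hRint : ∀ T : ℕ, Integrable
      (fun ω => LQR.runningCost A B Q R T (fun t => w t ω) (ustar T ω)) μ := fun T => by
    -- By uniqueness the final state is the explicit one, which is square integrable, so the running
    -- cost is integrable as the total cost minus the terminal term.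
    have hx := LQR.l2vec_optState A B Q R Qf hw.l2 T T
    have h := (hTint T).sub (hx.integrable_dotProduct (hx.mulVec Qf))
    refine h.congr (ae_of_all _ fun ω => ?_)
    simp only [Pi.sub_apply, LQR.totalCost]
    rw [((hopt T ω).eq_opt hQ hR hQf).2 T le_rfl, add_sub_cancel_right]
  have hYint := LQR.integrable_optValue A B Q R Y hw.l2
  have h0int := LQR.integrable_optValue A B Q R 0 hw.l2
  have hPint := LQR.integrable_optValue A B Q R P hw.l2
  have hcomp := fun (η : ℝ) (hη : 0 < η) =>
    LQR.exists_integral_optValue_le hQ hR hY hC hstab hw hη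
  have h0P : ∀ T, ∫ ω, LQR.optValue A B Q R 0 T (fun t => w t ω) ∂μ
      ≤ ∫ ω, LQR.optValue A B Q R P T (fun t => w t ω) ∂μ := fun T =>
    integral_mono (h0int T) (hPint T) fun ω => LQR.optValue_mono A B Q R hQ hR .zero hP.1
      (fun x => by simpa using hP.1.form_nonneg x) T _
  have hPYi : ∀ T, ∫ ω, LQR.optValue A B Q R P T (fun t => w t ω) ∂μ
      ≤ ∫ ω, LQR.optValue A B Q R Y T (fun t => w t ω) ∂μ := fun T =>
    integral_mono (hPint T) (hYint T) fun ω => LQR.optValue_mono A B Q R hQ hR hP.1 hY hPY T _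
  -- The reference sequence J_P also lies between J_0 and J_Y. As J_Y exceeds J_0 only by a factor 1
  -- + η and ηT + D, every sequence in this range has the slope of J_P.
  have key : ∀ b : ℕ → ℝ,
      (∀ T, ∫ ω, LQR.optValue A B Q R 0 T (fun t => w t ω) ∂μ ≤ b T) →
      (∀ T, b T ≤ ∫ ω, LQR.optValue A B Q R Y T (fun t => w t ω) ∂μ) →
      Tendsto (fun T : ℕ => (T : ℝ)⁻¹ * b T) atTop
        (𝓝 ((W * LQR.schurS B R P).trace - ∑' i, LQR.offlineTerm A B R P W i)) := by
    intro b hb0 hbY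
    refine LQR.tendsto_slope_of_comparable
      (fun T => integral_nonneg fun ω => LQR.optValue_nonneg A B Q R P hQ hR hP.1 T _)
      (hP.tendsto_optValue hQ hR hw) (fun η hη => ?_) fun η hη => ?_
    · obtain ⟨D, hD⟩ := hcomp η hη
      refine ⟨D, fun T => (hbY T).trans ((hD T).trans ?_)⟩
      have := mul_le_mul_of_nonneg_left (h0P T) (show 0 ≤ 1 + η by positivity)
      linarith
    · obtain ⟨D, hD⟩ := hcomp η hη
      refine ⟨D, fun T => (hPYi T).trans ((hD T).trans ?_)⟩
      gcongr
      exact hb0 T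
  have hrunle : ∀ T ω, LQR.runningCost A B Q R T (fun t => w t ω) (ustar T ω)
      ≤ LQR.totalCost A B Q R Qf T (fun t => w t ω) (ustar T ω) := fun T ω =>
    le_add_of_nonneg_right (hQf.form_nonneg _)
  have htotY : ∀ T, ∫ ω, LQR.totalCost A B Q R Qf T (fun t => w t ω) (ustar T ω) ∂μ
      ≤ ∫ ω, LQR.optValue A B Q R Y T (fun t => w t ω) ∂μ := fun T =>
    integral_mono (hTint T) (hYint T) fun ω =>
      (htot T ω).trans_le (LQR.optValue_mono A B Q R hQ hR hQf hY hQfY T _)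
  -- The running cost of the policy optimal for Qf is sandwiched without being computed: below by
  -- the optimum for weight 0, above by its own total cost.
  have h0run : ∀ T, ∫ ω, LQR.optValue A B Q R 0 T (fun t => w t ω) ∂μ
      ≤ ∫ ω, LQR.runningCost A B Q R T (fun t => w t ω) (ustar T ω) ∂μ := fun T =>
    integral_mono (h0int T) (hRint T) fun ω =>
      LQR.optValue_zero_le_runningCost A B Q R hQ hR T _ _
  have hruntot : ∀ T, ∫ ω, LQR.runningCost A B Q R T (fun t => w t ω) (ustar T ω) ∂μ
      ≤ ∫ ω, LQR.totalCost A B Q R Qf T (fun t => w t ω) (ustar T ω) ∂μ := fun T =>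
    integral_mono (hRint T) (hTint T) fun ω => hrunle T ω
  refine ⟨hRint, ?_, hTint, ?_⟩
  · simp only [integral_const_mul, one_div]
    exact key _ h0run fun T => (hruntot T).trans (htotY T)
  · simp only [integral_const_mul, one_div]
    exact key _ (fun T => (h0run T).trans (hruntot T)) htotY
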